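/- **Proposition (score test for the biased clusters).** *Setting.* Let $X, X_1, X_2, \ldots$ be iid random vectors in $\mathbb{R}^d_+$, let $|x| = \sum_i |x_i|$, and let $\pi$ be the Euclidean projection onto the simplex $\mathbb{S}^{d-1}_+ = \{x \in \mathbb{R}^d_+ : |x| = 1\}$. For nonempty $\beta \subset \{1, \ldots, d\}$ (a *cluster*) let $C_\beta$ be the set of $x \in \mathbb{S}^{d-1}_+$ with $x_i > 0$ for $i \in \beta$ and $x_i = 0$ for $i \notin \beta$. Let $u_n \to \infty$ be thresholds such that $k_n := n\,\mathbb{P}(|X| > u_n) \to \infty$, and put $$p_n(\beta) = \mathbb{P}(\pi(X/u_n) \in C_\beta \mid |X| > u_n), \qquad T_n(\beta) = \#\{i \le n : \pi(X_i/u_n) \in C_\beta,\ |X_i| > u_n\},$$ $$\mathcal{S}_k^\infty = \{\beta : k_n p_n(\beta) \to \infty\}, \qquad s_\infty = \# \mathcal{S}_k^\infty, \qquad \widehat{\mathcal{S}}_n = \{\beta : T_n(\beta) > 0\}.$$ For each $n$ let $\beta_{n,1}, \ldots, \beta_{n,s_\infty}$ be an enumeration of $\mathcal{S}_k^\infty$.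 Fix $0 \le s_1 < s_2 \le s_\infty$ and assume $H_0$: for all large $n$, $p_n(\beta_{n,j}) = \rho_n$ for every $j = s_1+1, \ldots, s_2$. For numbers $t_{s_1+1}, \ldots, t_{s_2}$ let $$\mathcal{T}_n(t) = k_n \sum_{j=s_1+1}^{s_2} \frac{(t_j/k_n - \hat\rho_n)^2}{\hat\rho_n}, \qquad \hat\rho_n = \frac{1}{k_n (s_2 - s_1)} \sum_{j=s_1+1}^{s_2} t_j .$$ *Conclusion.* Let $n \to \infty$. 1. Conditionally on the event $\mathcal{S}_k^\infty = \widehat{\mathcal{S}}_n$ (which has positive probability for all large $n$), the statistic $\mathcal{T}_n$ computed from $t_j = T_n(\beta_{n,j})$ converges in distribution to $\chi^2(s_2 - s_1 - 1)$. 2. Let $T_{n,1} \ge T_{n,2} \ge \ldots \ge T_{n,2^d-1}$ be the counts $T_n(\beta)$ in decreasing order. If in addition the tested clusters are asymptotically separated from the other clusters of $\mathcal{S}_k^\infty$, namely $\sqrt{k_n p_n(\beta_{n,j})} - \sqrt{k_n \rho_n} \to +\infty$ for each $j \le s_1$ and $\sqrt{k_n \rho_n} - \sqrt{k_n p_n(\beta_{n,j})}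 \to +\infty$ for each $s_2 < j \le s_\infty$, then, conditionally on the same event, the statistic $\mathcal{T}_n$ computed from $t_j = T_{n,j}$ also converges in distribution to $\chi^2(s_2 - s_1 - 1)$. Here $\chi^2(m)$ is the law of the sum of squares of $m$ independent standard normal variables, and $\chi^2(0)$ is the Dirac mass at $0$. -/

import Mathlib

open MeasureTheory ProbabilityTheory Filter Topology

/-- The `ℓ¹`-norm of a vector of `ℝ^d`. -/
noncomputable def l1Norm {d : ℕ} (x : Fin d → ℝ) : ℝ := ∑ i, |x i|

/-- `y` is the Euclidean projection of `x` onto the simplex `{y ≥ 0, y₁ + … + y_d = 1}`: the point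
of the simplex at minimal Euclidean distance from `x`. -/
def IsSimplexProj {d : ℕ} (x y : Fin d → ℝ) : Prop :=
  y ∈ stdSimplex ℝ (Fin d) ∧
    ∀ z ∈ stdSimplex ℝ (Fin d), ∑ i, (x i - y i) ^ 2 ≤ ∑ i, (x i - z i) ^ 2

/-- The Euclidean projection onto the simplex exists and is unique as soon as `d ≥ 1`. -/
theorem existsUnique_isSimplexProj {d : ℕ} [NeZero d] (x : Fin d → ℝ) :
    ∃! y, IsSimplexProj x y := by
  have hne : (stdSimplex ℝ (Fin d)).Nonempty := ⟨_, single_mem_stdSimplex ℝ (0 : Fin d)⟩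
  obtain ⟨y, hy, hmin⟩ := (isCompact_stdSimplex ℝ (Fin d)).exists_isMinOn hne
    (f := fun y => ∑ i, (x i - y i) ^ 2) (by fun_prop)
  refine ⟨y, ⟨hy, fun z hz => hmin hz⟩, ?_⟩
  rintro w ⟨hw, hwmin⟩
  have h1 := hwmin y hy
  have hm : (1 / 2 : ℝ) • y + (1 / 2 : ℝ) • w ∈ stdSimplex ℝ (Fin d) :=
    convex_stdSimplex ℝ (Fin d) hy hw (by norm_num) (by norm_num) (by norm_num)
  have h2 := hwmin _ hm
  have h4 : ∑ i, (x i - ((1 / 2 : ℝ) • y + (1 / 2 : ℝ) • w) i) ^ 2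
      = (1 / 2) * ∑ i, (x i - y i) ^ 2 + (1 / 2) * ∑ i, (x i - w i) ^ 2
        - (1 / 4) * ∑ i, (w i - y i) ^ 2 := by
    rw [Finset.mul_sum, Finset.mul_sum, Finset.mul_sum, ← Finset.sum_add_distrib,
      ← Finset.sum_sub_distrib]
    refine Finset.sum_congr rfl fun i _ => ?_
    simp only [Pi.add_apply, Pi.smul_apply, smul_eq_mul]
    ring
  have h3 : ∑ i, (x i - y i) ^ 2 ≤ ∑ i, (x i - w i) ^ 2 := hmin hw
  have h5 : ∑ i, (w i - y i) ^ 2 ≤ 0 := by linarith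
  have h6 : ∀ i ∈ Finset.univ, (w i - y i) ^ 2 = 0 :=
    (Finset.sum_eq_zero_iff_of_nonneg fun i _ => sq_nonneg _).1
      (le_antisymm h5 (Finset.sum_nonneg fun i _ => sq_nonneg _))
  funext i
  have := h6 i (Finset.mem_univ i)
  have := pow_eq_zero_iff (two_ne_zero) |>.1 this
  linarith

/-- The Euclidean projection `π` onto the simplex. (For `d = 0` the simplex is empty and the value
is irrelevant: there is no nonempty cluster.) -/
noncomputable def simplexProj {d : ℕ} (x : Fin d → ℝ) : Fin d → ℝ :=
  Classical.epsilon (IsSimplexProj x)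

theorem simplexProj_spec {d : ℕ} [NeZero d] (x : Fin d → ℝ) : IsSimplexProj x (simplexProj x) :=
  Classical.epsilon_spec (existsUnique_isSimplexProj x).exists

/-- `C_β`: the points of the simplex whose set of positive coordinates is exactly `β`. -/
def coneC {d : ℕ} (β : Finset (Fin d)) : Set (Fin d → ℝ) :=
  {x | x ∈ stdSimplex ℝ (Fin d) ∧ (∀ i ∈ β, 0 < x i) ∧ ∀ i ∉ β, x i = 0}

section Sample

variable {Ω : Type*} [MeasurableSpace Ω] {d : ℕ}

/-- The level `k_n = n P(|X| > u_n)`, where `X = X 0` is the generic vector of the sample. -/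
noncomputable def level (P : Measure Ω) (X : ℕ → Ω → Fin d → ℝ) (u : ℕ → ℝ) (n : ℕ) : ℝ :=
  n * P.real {ω | u n < l1Norm (X 0 ω)}

/-- `p_n(β) = P(π(X / u_n) ∈ C_β ∣ |X| > u_n)`. -/
noncomputable def clusterProb (P : Measure Ω) (X : ℕ → Ω → Fin d → ℝ) (u : ℕ → ℝ) (n : ℕ)
    (β : Finset (Fin d)) : ℝ :=
  (P[|{ω | u n < l1Norm (X 0 ω)}]).real {ω | simplexProj ((u n)⁻¹ • X 0 ω) ∈ coneC β}

open Classical in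
/-- `T_n(β)`: the number of indices `i` among the first `n` with `π(X_i / u_n) ∈ C_β` and
`|X_i| > u_n`. The sample `X_1, …, X_n` is `X 0, …, X (n - 1)`. -/
noncomputable def clusterCount (X : ℕ → Ω → Fin d → ℝ) (u : ℕ → ℝ) (n : ℕ)
    (β : Finset (Fin d)) (ω : Ω) : ℕ :=
  ((Finset.range n).filter fun i =>
    simplexProj ((u n)⁻¹ • X i ω) ∈ coneC β ∧ u n < l1Norm (X i ω)).card

/-- `S_k^∞`: the nonempty clusters `β` with `k_n p_n(β) → ∞`. -/
def clustersInfty (P : Measure Ω) (X : ℕ → Ω → Fin d → ℝ) (u : ℕ → ℝ) :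
    Set (Finset (Fin d)) :=
  {β | β.Nonempty ∧ Tendsto (fun n => level P X u n * clusterProb P X u n β) atTop atTop}

/-- `Ŝ_n`: the nonempty clusters `β` with `T_n(β) > 0`. -/
def clustersHat (X : ℕ → Ω → Fin d → ℝ) (u : ℕ → ℝ) (n : ℕ) (ω : Ω) :
    Set (Finset (Fin d)) :=
  {β | β.Nonempty ∧ 0 < clusterCount X u n β ω}

/-- The event `S_k^∞ = Ŝ_n`. -/
def eventEq (P : Measure Ω) (X : ℕ → Ω → Fin d → ℝ) (u : ℕ → ℝ) (n : ℕ) : Set Ω :=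
  {ω | clustersInfty P X u = clustersHat X u n ω}

/-- `T_{n,j}` for `j = 1, …, 2^d - 1`: the `j`-th largest (with multiplicity) of the counts
`T_n(β)`, `β` ranging over the nonempty clusters. -/
noncomputable def orderedCount (X : ℕ → Ω → Fin d → ℝ) (u : ℕ → ℝ) (n j : ℕ) (ω : Ω) : ℕ :=
  ((((Finset.univ : Finset (Finset (Fin d))).filter (·.Nonempty)).val.map
    fun β => clusterCount X u n β ω).sort (· ≥ ·)).getD (j - 1) 0

/-- The score statistic `k ∑_{j=s₁+1}^{s₂} (T_j / k - ρ̂)² / ρ̂` with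
`ρ̂ = k⁻¹ (s₂ - s₁)⁻¹ ∑_{j=s₁+1}^{s₂} T_j`. -/
noncomputable def scoreStat (k : ℝ) (s₁ s₂ : ℕ) (T : ℕ → ℝ) : ℝ :=
  let ρ : ℝ := k⁻¹ * ((s₂ : ℝ) - s₁)⁻¹ * ∑ j ∈ Finset.Icc (s₁ + 1) s₂, T j
  k * ∑ j ∈ Finset.Icc (s₁ + 1) s₂, (T j / k - ρ) ^ 2 / ρ

/-- The chi-squared distribution with `m` degrees of freedom: the law of the sum of squares of `m`
independent standard normal variables (the Dirac mass at `0` if `m = 0`). -/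
noncomputable def chiSquared (m : ℕ) : Measure ℝ :=
  (Measure.pi fun _ : Fin m => gaussianReal 0 1).map fun x => ∑ i, x i ^ 2

instance instIsProbabilityMeasureChiSquared (m : ℕ) : IsProbabilityMeasure (chiSquared m) :=
  Measure.isProbabilityMeasure_map (Measurable.aemeasurable (by fun_prop))

/-- Convergence in distribution of `Y n`, conditionally on the events `E n`, to the law `ν`: for
large `n` the event `E n` has positive probability, and the law of `Y n` under `P(· ∣ E n)`
converges weakly to `ν`. -/
def CondTendstoInDistribution (P : Measure Ω) (E : ℕ → Set Ω)
    (Y : ℕ → Ω → ℝ) (ν : Measure ℝ) [IsProbabilityMeasure ν] : Prop :=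
  (∀ n, AEMeasurable (Y n) (P[|E n])) ∧ (∀ᶠ n in atTop, 0 < P (E n)) ∧
    Tendsto (β := FiniteMeasure ℝ)
      (fun n => ⟨(P[|E n]).map (Y n), inferInstance⟩) atTop (𝓝 ⟨ν, inferInstance⟩)

end Sample

/-! Let `A_n` be the event that no observation falls into the cell of a nonempty cluster outside
`S_k^∞`. It contains the event `S_k^∞ = Ŝ_n`, and its probability may be arbitrarily small.
Conditioning on it is nevertheless harmless: avoiding a set `D` constrains each observation
separately, so given `A_n` the counts of disjoint cells outside `D` are still multinomial, with cell
probabilities `p` replaced by `p / (1 - P(D))` (`integral_cond_exp_sum_cellCount`). Equal cell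
probabilities stay equal, and expected counts can only grow.

Given `A_n`, each of the finitely many clusters of `S_k^∞` is missed with exponentially small
probability in `k_n p_n(β)`. Hence `S_k^∞ = Ŝ_n` has conditional probability tending to 1, and the
further conditioning does not change weak limits (`tendsto_integral_cond_of_tendsto`).

What remains is Pearson's theorem for `m + 1` equiprobable cells of probability `r_n` with `n r_n →
∞` (`tendsto_integral_pearsonStat`). With `h = (n r_n)^(-1/2)`, the deviations from the mean times
`h`, together with the mean times `h²`, converge jointly to a centred Gaussian vector and the
constant 1, by characteristic functions. Because the deviations sum to zero, the first order terms
cancel exactly, so `r_n` need not tend to 0. The squared length of the centred Gaussian vector is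
chi-squared with `m` degrees of freedom.

For the ordered counts, an optimised exponential bound shows that two counts are in the wrong order
with probability at most `exp (-(√a - √b)²)`, where `a` and `b` are their unconditional
expectations; this is why separation is measured on square roots. Off these finitely many bad events
the ranks `s₁ + 1, …, s₂` are occupied by the tested clusters, and the statistic, being symmetric,
equals that of the first conclusion. -/

/-! ### Pearson's chi-squared limit for equiprobable cells -/

/-- The sum of squared deviations from the mean of a standard Gaussian vector in dimension `m + 1`
has a chi-squared distribution with `m` degrees of freedom. -/
theorem stdGaussian_map_sum_sq_sub_mean (m : ℕ) :
    (stdGaussian (EuclideanSpace ℝ (Fin (m + 1)))).map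
      (fun g => ∑ j, (g j - (m + 1 : ℝ)⁻¹ * ∑ l, g l) ^ 2) = chiSquared m := by
  have hm : (0 : ℝ) < m + 1 := by positivity
  -- In an orthonormal basis starting with this unit diagonal vector, centring deletes the
  -- coordinate of index 0 and leaves `m` independent standard normals.
  let e : EuclideanSpace ℝ (Fin (m + 1)) := WithLp.toLp 2 fun _ => (√(m + 1 : ℝ))⁻¹
  have he : ‖e‖ = 1 := by
    rw [EuclideanSpace.norm_eq, Real.sqrt_eq_one]
    simp only [e, Real.norm_eq_abs, sq_abs, inv_pow, Real.sq_sqrt hm.le, Finset.sum_const,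
      Finset.card_univ, Fintype.card_fin, nsmul_eq_mul]
    push_cast
    field_simp
  obtain ⟨b, hb⟩ := Orthonormal.exists_orthonormalBasis_extension_of_card_eq (𝕜 := ℝ)
    (E := EuclideanSpace ℝ (Fin (m + 1))) (ι := Fin (m + 1)) (by simp)
    (v := fun _ => e) (s := {0}) (by
      rw [orthonormal_iff_ite]
      rintro ⟨i, hi⟩ ⟨j, hj⟩
      obtain rfl : i = 0 := hi
      obtain rfl : j = 0 := hj
      simp [he])
  have hb0 : b 0 = e := hb 0 rfl
  have key : ∀ g : EuclideanSpace ℝ (Fin (m + 1)),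
      ∑ j, (g j - (m + 1 : ℝ)⁻¹ * ∑ l, g l) ^ 2 = ∑ k : Fin m, b.repr g k.succ ^ 2 := by
    intro g
    have h1 : ‖g‖ ^ 2 = ∑ k, b.repr g k ^ 2 := by
      rw [← b.repr.norm_map g, EuclideanSpace.norm_sq_eq]
      simp
    have h2 : b.repr g 0 = (√(m + 1 : ℝ))⁻¹ * ∑ l, g l := by
      rw [b.repr_apply_apply, hb0, PiLp.inner_apply, Finset.mul_sum]
      simp [e, mul_comm]
    rw [Fin.sum_univ_succ, h2, mul_pow, inv_pow, Real.sq_sqrt hm.le,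
      EuclideanSpace.norm_sq_eq] at h1
    simp only [Real.norm_eq_abs, sq_abs] at h1
    have h3 : ∀ c : ℝ, ∑ j, (g j - c) ^ 2 = ∑ j, g j ^ 2 - 2 * c * ∑ j, g j + (m + 1) * c ^ 2 := by
      intro c
      simp only [sub_sq, Finset.sum_add_distrib, Finset.sum_sub_distrib, Finset.mul_sum]
      simp only [Finset.sum_const, Finset.card_univ, Fintype.card_fin, nsmul_eq_mul]
      push_cast
      congr 2
      exact Finset.sum_congr rfl fun _ _ => by ring
    rw [h3, h1]
    field_simp
    ring
  simp_rw [key]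
  rw [stdGaussian_eq_map_pi_orthonormalBasis b, Measure.map_map (by fun_prop) (by fun_prop)]
  have h4 : ((fun g => ∑ k : Fin m, b.repr g k.succ ^ 2) ∘
      fun x : Fin (m + 1) → ℝ => ∑ i, x i • b i) =
      (fun y : Fin m → ℝ => ∑ k, y k ^ 2) ∘ (Prod.snd : ℝ × (Fin m → ℝ) → Fin m → ℝ) ∘
        (MeasurableEquiv.piFinSuccAbove (fun _ : Fin (m + 1) => ℝ) 0) := by
    funext x
    simp only [Function.comp_apply, map_sum, map_smul, b.repr_self]
    refine Finset.sum_congr rfl fun k _ => ?_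
    simp [MeasurableEquiv.piFinSuccAbove, Pi.single_apply, Fin.tail]
  rw [h4, ← Measure.map_map (by fun_prop) (by fun_prop),
    ← Measure.map_map (by fun_prop) (by fun_prop),
    (measurePreserving_piFinSuccAbove (fun _ : Fin (m + 1) => gaussianReal 0 1) 0).map_eq,
    Measure.map_snd_prod]
  simp [chiSquared]

/-- Second order expansion of `h ↦ exp (i (α h + β h²))` at `0`. -/
theorem tendsto_exp_sub_one_sub_div_sq (α β : ℝ) :
    Tendsto (fun h : ℝ => (Complex.exp (((α * h + β * h ^ 2 : ℝ) : ℂ) * Complex.I) - 1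
      - (α * h : ℝ) * Complex.I) / (h : ℂ) ^ 2) (𝓝[≠] 0)
      (𝓝 (β * Complex.I - (α : ℂ) ^ 2 / 2)) := by
  let x : ℝ → ℂ := fun h => ((α * h + β * h ^ 2 : ℝ) : ℂ) * Complex.I
  have hx0 : Tendsto x (𝓝[≠] 0) (𝓝 0) := by
    refine tendsto_nhdsWithin_of_tendsto_nhds ?_
    have : Continuous x := by fun_prop
    simpa [x] using this.tendsto 0
  have h1 := (Complex.exp_sub_sum_range_isBigO_pow 3).comp_tendsto hx0
  have hxO : x =O[𝓝[≠] 0] (fun h : ℝ => h) := by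
    have : x = fun h : ℝ => (h : ℂ) * (((α + β * h : ℝ) : ℂ) * Complex.I) := by
      funext h; simp only [x]; push_cast; ring
    rw [this]
    have hb : (fun h : ℝ => (((α + β * h : ℝ) : ℂ) * Complex.I)) =O[𝓝[≠] 0] (fun _ => (1 : ℝ)) := by
      refine Tendsto.isBigO_one (c := (α : ℂ) * Complex.I) ℝ ?_
      refine tendsto_nhdsWithin_of_tendsto_nhds ?_
      have : Continuous (fun h : ℝ => (((α + β * h : ℝ) : ℂ) * Complex.I)) := by fun_prop
      simpa using this.tendsto 0
    have hh : (fun h : ℝ => (h : ℂ)) =O[𝓝[≠] 0] (fun h : ℝ => h) :=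
      Asymptotics.isBigO_of_le _ fun h => by simp
    simpa using hh.mul hb
  have h2 : (fun h : ℝ => Complex.exp (x h) - ∑ i ∈ Finset.range 3, x h ^ i / (i.factorial : ℂ))
      =O[𝓝[≠] 0] (fun h : ℝ => h ^ 3) := h1.trans (hxO.pow 3)
  have h3 : Tendsto (fun h : ℝ => (Complex.exp (x h) -
      ∑ i ∈ Finset.range 3, x h ^ i / (i.factorial : ℂ)) / (h : ℂ) ^ 2) (𝓝[≠] 0) (𝓝 0) := by
    have h4 : (fun h : ℝ => (Complex.exp (x h) -
        ∑ i ∈ Finset.range 3, x h ^ i / (i.factorial : ℂ)) * ((h : ℂ) ^ 2)⁻¹)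
        =O[𝓝[≠] 0] (fun h : ℝ => h ^ 3 * (h ^ 2)⁻¹) :=
      h2.mul (Asymptotics.isBigO_of_le _ fun h => by simp)
    simp only [div_eq_mul_inv] at h4 ⊢
    refine h4.trans_tendsto ?_
    refine Tendsto.congr' (f₁ := fun h : ℝ => h) ?_ (tendsto_nhdsWithin_of_tendsto_nhds tendsto_id)
    filter_upwards [self_mem_nhdsWithin] with h hh
    have : h ≠ 0 := hh
    field_simp
  -- This is exactly what the quadratic Taylor polynomial of `exp` contributes once `1 + iαh` is
  -- removed and the rest is divided by `h²`.
  have h5 : Tendsto (fun h : ℝ => (β : ℂ) * Complex.I - ((α + β * h : ℝ) : ℂ) ^ 2 / 2)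
      (𝓝[≠] 0) (𝓝 (β * Complex.I - (α : ℂ) ^ 2 / 2)) := by
    refine tendsto_nhdsWithin_of_tendsto_nhds ?_
    have : Continuous (fun h : ℝ => (β : ℂ) * Complex.I - ((α + β * h : ℝ) : ℂ) ^ 2 / 2) := by
      fun_prop
    simpa using this.tendsto 0
  have h6 := h3.add h5
  rw [zero_add] at h6
  refine h6.congr' ?_
  filter_upwards [self_mem_nhdsWithin] with h hh
  have hh' : (h : ℂ) ≠ 0 := by exact_mod_cast (show h ≠ 0 from hh)
  simp only [x, Finset.sum_range_succ, Finset.sum_range_zero, Nat.factorial]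
  push_cast
  field_simp
  ring_nf
  simp only [Complex.I_sq]
  ring

/-- The chi-squared statistic of the counts `t` for the hypothesis that all cells are equally
likely. -/
noncomputable def pearsonStat {m : ℕ} (t : Fin (m + 1) → ℝ) : ℝ :=
  (∑ j, (t j - (m + 1 : ℝ)⁻¹ * ∑ l, t l) ^ 2) / ((m + 1 : ℝ)⁻¹ * ∑ l, t l)

/-- Counts rescaled so that their deviations from the mean are multiplied by `h` and their mean is
multiplied by `h²`. -/
noncomputable def rescaledCounts {m : ℕ} (h : ℝ) (t : Fin (m + 1) → ℝ) :
    EuclideanSpace ℝ (Fin (m + 1)) :=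
  WithLp.toLp 2 fun j => h * (t j - (m + 1 : ℝ)⁻¹ * ∑ l, t l) + h ^ 2 * ((m + 1 : ℝ)⁻¹ * ∑ l, t l)

theorem continuous_rescaledCounts {m : ℕ} (h : ℝ) :
    Continuous (rescaledCounts (m := m) h) := by
  unfold rescaledCounts
  fun_prop

theorem mean_rescaledCounts {m : ℕ} (h : ℝ) (t : Fin (m + 1) → ℝ) :
    (m + 1 : ℝ)⁻¹ * ∑ l, rescaledCounts h t l = h ^ 2 * ((m + 1 : ℝ)⁻¹ * ∑ l, t l) := by
  have hm : (m + 1 : ℝ) ≠ 0 := by positivity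
  simp only [rescaledCounts, Finset.sum_add_distrib, ← Finset.mul_sum, Finset.sum_sub_distrib,
    Finset.sum_const, Finset.card_univ, Fintype.card_fin, nsmul_eq_mul]
  push_cast
  field_simp
  ring

theorem pearsonStat_rescaledCounts {m : ℕ} {h : ℝ} (hh : h ≠ 0) (t : Fin (m + 1) → ℝ) :
    pearsonStat (rescaledCounts h t) = pearsonStat t := by
  unfold pearsonStat
  rw [mean_rescaledCounts]
  have : ∀ j, rescaledCounts h t j - h ^ 2 * ((m + 1 : ℝ)⁻¹ * ∑ l, t l)
      = h * (t j - (m + 1 : ℝ)⁻¹ * ∑ l, t l) := by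
    intro j; simp only [rescaledCounts]; ring
  simp only [this, mul_pow, ← Finset.mul_sum]
  rw [mul_div_mul_left _ _ (pow_ne_zero 2 hh)]

/-- Centring is self-adjoint, so it can be moved from the counts to `s`. The result is a linear form
in the raw counts, to which their joint generating function applies. -/
theorem inner_rescaledCounts {m : ℕ} (h : ℝ) (t : Fin (m + 1) → ℝ)
    (s : EuclideanSpace ℝ (Fin (m + 1))) :
    inner ℝ (rescaledCounts h t) s = ∑ j, ((s j - (m + 1 : ℝ)⁻¹ * ∑ l, s l) * h
      + ((m + 1 : ℝ)⁻¹ * ∑ l, s l) * h ^ 2) * t j := by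
  have hm : (m + 1 : ℝ) ≠ 0 := by positivity
  rw [PiLp.inner_apply]
  simp only [rescaledCounts, RCLike.inner_apply, conj_trivial, mul_add, add_mul, mul_sub, sub_mul,
    Finset.sum_add_distrib, Finset.sum_sub_distrib]
  have h1 : ∀ c : ℝ, ∑ x, s x * c = c * ∑ x, s x := fun c => by rw [← Finset.sum_mul, mul_comm]
  have h2 : ∑ x, s x * (h * t x) = ∑ x, s x * h * t x := by simp only [mul_assoc]
  rw [h1, h1, ← Finset.mul_sum, ← Finset.mul_sum, h2]
  ring

/-- The law here is the limit of the rescaled counts: deviations become a centred Gaussian vector,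
the mean becomes 1. The exponent is kept as a sum over `j` to match the cellwise expansion of the
generating function. -/
theorem charFun_map_rescaledCounts_stdGaussian (m : ℕ) (s : EuclideanSpace ℝ (Fin (m + 1))) :
    charFun ((stdGaussian (EuclideanSpace ℝ (Fin (m + 1)))).map fun g =>
      WithLp.toLp 2 fun j => g j - (m + 1 : ℝ)⁻¹ * ∑ l, g l + 1) s =
    Complex.exp (∑ j, ((((m + 1 : ℝ)⁻¹ * ∑ l, s l : ℝ) : ℂ) * Complex.I
      - ((s j - (m + 1 : ℝ)⁻¹ * ∑ l, s l : ℝ) : ℂ) ^ 2 / 2)) := by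
  have hm : (m + 1 : ℝ) ≠ 0 := by positivity
  rw [charFun_apply, integral_map (Measurable.aemeasurable (by fun_prop)) (by fun_prop)]
  let s' : EuclideanSpace ℝ (Fin (m + 1)) :=
    WithLp.toLp 2 fun j => s j - (m + 1 : ℝ)⁻¹ * ∑ l, s l
  have h1 : ∀ g : EuclideanSpace ℝ (Fin (m + 1)),
      inner ℝ (WithLp.toLp 2 fun j => g j - (m + 1 : ℝ)⁻¹ * ∑ l, g l + 1 :
        EuclideanSpace ℝ (Fin (m + 1))) s
      = inner ℝ g s' + ∑ l, s l := by
    intro g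
    simp only [PiLp.inner_apply, s', RCLike.inner_apply, conj_trivial, mul_add, mul_sub, sub_mul,
      Finset.sum_add_distrib, Finset.sum_sub_distrib, mul_one]
    have h1 : ∀ c : ℝ, ∑ x, s x * c = c * ∑ x, s x := fun c => by rw [← Finset.sum_mul, mul_comm]
    rw [h1, ← Finset.mul_sum]
    ring
  simp_rw [h1]
  push_cast
  simp_rw [add_mul, Complex.exp_add]
  rw [integral_mul_const, ← charFun_apply, charFun_stdGaussian, ← Complex.exp_add]
  congr 1
  rw [Finset.sum_sub_distrib, Finset.sum_const, Finset.card_univ, Fintype.card_fin, nsmul_eq_mul,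
    ← Complex.ofReal_pow, EuclideanSpace.norm_sq_eq]
  simp only [s', Real.norm_eq_abs, sq_abs]
  push_cast
  have hm' : (m + 1 : ℂ) ≠ 0 := by exact_mod_cast hm
  rw [← Finset.sum_div]
  generalize ∑ j, ((s j : ℂ) - ((m : ℂ) + 1)⁻¹ * ∑ l, (s l : ℂ)) ^ 2 = Q
  field_simp
  ring

/-- If the joint moment generating function of the counts `T n j` is that of `m + 1` cells of common
probability `r n` in a multinomial sample of size `n` with `n * r n → ∞`, then the chi-squared
statistic of these counts converges in distribution to the chi-squared law with `m` degrees of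
freedom. -/
theorem tendsto_integral_pearsonStat {Ω : Type*} [MeasurableSpace Ω] (μ : ℕ → Measure Ω)
    [∀ n, IsProbabilityMeasure (μ n)] {m : ℕ} (T : ℕ → Fin (m + 1) → Ω → ℝ)
    (hT : ∀ n j, Measurable (T n j)) (r : ℕ → ℝ)
    (hr : Tendsto (fun n : ℕ => n * r n) atTop atTop)
    (hpgf : ∀ᶠ n : ℕ in atTop, ∀ z : Fin (m + 1) → ℂ,
      ∫ ω, Complex.exp (∑ j, z j * (T n j ω : ℂ)) ∂μ n
        = (1 + r n * ∑ j, (Complex.exp (z j) - 1)) ^ n)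
    (f : BoundedContinuousFunction ℝ ℝ) :
    Tendsto (fun n => ∫ ω, f (pearsonStat fun j => T n j ω) ∂μ n) atTop
      (𝓝 (∫ x, f x ∂chiSquared m)) := by
  let h : ℕ → ℝ := fun n => (√(n * r n))⁻¹
  have hh0 : Tendsto h atTop (𝓝 0) :=
    tendsto_inv_atTop_zero.comp (Real.tendsto_sqrt_atTop.comp hr)
  have hhne : ∀ᶠ n in atTop, h n ≠ 0 ∧ (h n ^ 2)⁻¹ = n * r n := by
    filter_upwards [hr.eventually_gt_atTop 0] with n hn
    refine ⟨(inv_pos.2 (Real.sqrt_pos.2 hn)).ne', ?_⟩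
    simp only [h, inv_pow, inv_inv, Real.sq_sqrt hn.le]
  let Z : ℕ → Ω → EuclideanSpace ℝ (Fin (m + 1)) := fun n ω => rescaledCounts (h n) fun j => T n j ω
  have hZ : ∀ n, Measurable (Z n) := fun n =>
    (continuous_rescaledCounts (h n)).measurable.comp (measurable_pi_lambda _ (hT n))
  let lim : EuclideanSpace ℝ (Fin (m + 1)) → EuclideanSpace ℝ (Fin (m + 1)) := fun g => WithLp.toLp 2 fun j => g j - (m + 1 : ℝ)⁻¹ * ∑ l, g l + 1
  have hlim : Measurable lim := by fun_prop
  let ν : ProbabilityMeasure (EuclideanSpace ℝ (Fin (m + 1))) := ⟨(stdGaussian (EuclideanSpace ℝ (Fin (m + 1)))).map lim,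
    Measure.isProbabilityMeasure_map hlim.aemeasurable⟩
  let M : ℕ → ProbabilityMeasure (EuclideanSpace ℝ (Fin (m + 1))) := fun n =>
    ⟨(μ n).map (Z n), Measure.isProbabilityMeasure_map (hZ n).aemeasurable⟩
  have hconv : Tendsto M atTop (𝓝 ν) := by
    rw [ProbabilityMeasure.tendsto_iff_tendsto_charFun]
    intro s
    let sb : ℝ := (m + 1 : ℝ)⁻¹ * ∑ l, s l
    have h1 := tendsto_finsetSum Finset.univ fun (j : Fin (m + 1)) _ =>
      (tendsto_exp_sub_one_sub_div_sq (s j - sb) sb).comp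
        (tendsto_nhdsWithin_iff.2 ⟨hh0, hhne.mono fun n hn => hn.1⟩)
    have h2 : Tendsto (fun n : ℕ => (n : ℂ) * (r n * ∑ j : Fin (m + 1),
        (Complex.exp ((((s j - sb) * h n + sb * h n ^ 2 : ℝ) : ℂ) * Complex.I) - 1))) atTop
        (𝓝 (∑ j, ((sb : ℂ) * Complex.I - ((s j - sb : ℝ) : ℂ) ^ 2 / 2))) := by
      refine h1.congr' ?_
      filter_upwards [hhne] with n hn
      -- The terms of order `h` would be multiplied by `n r_n = h⁻²` and diverge; they cancel
      -- because the deviations of `s` sum to zero.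
      have h3 : ∑ j : Fin (m + 1), (((s j - sb) * h n : ℝ) : ℂ) = 0 := by
        rw [← Complex.ofReal_sum, ← Finset.sum_mul, Finset.sum_sub_distrib]
        have hm : (m + 1 : ℝ) ≠ 0 := by positivity
        simp only [sb, Finset.sum_const, Finset.card_univ, Fintype.card_fin, nsmul_eq_mul]
        push_cast
        field_simp
        simp
      have h4 : ((h n : ℂ) ^ 2)⁻¹ = n * r n := by exact_mod_cast congrArg Complex.ofReal hn.2
      simp only [Function.comp_apply, div_eq_mul_inv]
      rw [← Finset.sum_mul, Finset.sum_sub_distrib, ← Finset.sum_mul, h3, zero_mul, sub_zero, h4]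
      ring
    have h5 := Complex.tendsto_one_add_pow_exp_of_tendsto h2
    rw [← charFun_map_rescaledCounts_stdGaussian m s] at h5
    refine h5.congr' ?_
    filter_upwards [hpgf] with n hn
    rw [← hn]
    simp only [M, ProbabilityMeasure.coe_mk]
    rw [charFun_apply, integral_map (hZ n).aemeasurable (by fun_prop)]
    refine integral_congr_ae (Eventually.of_forall fun ω => ?_)
    simp only [Z, inner_rescaledCounts]
    congr 1
    push_cast
    rw [Finset.sum_mul]
    exact Finset.sum_congr rfl fun j _ => by simp only [sb]; push_cast; ring
  rw [ProbabilityMeasure.tendsto_iff_forall_integral_tendsto] at hconv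
  simp only [M, ProbabilityMeasure.coe_mk, ν] at hconv
  have hint : ∀ (F : BoundedContinuousFunction (EuclideanSpace ℝ (Fin (m + 1))) ℝ) n, ∫ z, F z ∂(μ n).map (Z n)
      = ∫ ω, F (Z n ω) ∂μ n := fun F n =>
    integral_map (hZ n).aemeasurable F.continuous.aestronglyMeasurable
  have hintlim : ∀ F : BoundedContinuousFunction (EuclideanSpace ℝ (Fin (m + 1))) ℝ, ∫ z, F z ∂(stdGaussian (EuclideanSpace ℝ (Fin (m + 1)))).map lim
      = ∫ g, F (lim g) ∂stdGaussian (EuclideanSpace ℝ (Fin (m + 1))) := fun F =>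
    integral_map hlim.aemeasurable F.continuous.aestronglyMeasurable
  simp only [hint, hintlim] at hconv
  have hm : (m + 1 : ℝ) ≠ 0 := by positivity
  have hmean : ∀ g : EuclideanSpace ℝ (Fin (m + 1)), (m + 1 : ℝ)⁻¹ * ∑ l, lim g l = 1 := by
    intro g
    simp only [lim, Finset.sum_add_distrib, Finset.sum_sub_distrib, Finset.sum_const,
      Finset.card_univ, Fintype.card_fin, nsmul_eq_mul]
    push_cast
    field_simp
    ring
  -- The statistic is discontinuous where the mean vanishes, so the denominator is truncated at 1/2.
  -- The function `φ` below equals 1 wherever the truncation acts and vanishes on the limit, so it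
  -- bounds the error.
  let G : C(EuclideanSpace ℝ (Fin (m + 1)), ℝ) := ⟨fun z => (∑ j, (z j - (m + 1 : ℝ)⁻¹ * ∑ l, z l) ^ 2) /
    max ((m + 1 : ℝ)⁻¹ * ∑ l, z l) (1 / 2), by
      refine Continuous.div (by fun_prop) (by fun_prop) fun z => ?_
      exact (lt_of_lt_of_le (by norm_num) (le_max_right _ _)).ne'⟩
  let φ : BoundedContinuousFunction (EuclideanSpace ℝ (Fin (m + 1))) ℝ := BoundedContinuousFunction.ofNormedAddCommGroup
    (fun z : EuclideanSpace ℝ (Fin (m + 1)) => min 1 (2 * |(m + 1 : ℝ)⁻¹ * ∑ l, z l - 1|)) (by fun_prop) 1 (fun z => by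
      rw [Real.norm_eq_abs, abs_of_nonneg (by positivity)]
      exact min_le_left _ _)
  have hG := hconv (f.compContinuous G)
  have hφ := hconv φ
  have hφlim : ∀ g, φ (lim g) = 0 := by
    intro g
    simp only [φ, BoundedContinuousFunction.coe_ofNormedAddCommGroup, hmean]
    simp
  simp only [hφlim, integral_zero] at hφ
  have hGlim : ∫ g, f.compContinuous G (lim g) ∂stdGaussian (EuclideanSpace ℝ (Fin (m + 1))) = ∫ x, f x ∂chiSquared m := by
    rw [← stdGaussian_map_sum_sq_sub_mean, integral_map (Measurable.aemeasurable (by fun_prop))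
      f.continuous.aestronglyMeasurable]
    refine integral_congr_ae (Eventually.of_forall fun g => ?_)
    simp only [BoundedContinuousFunction.compContinuous_apply, G, ContinuousMap.coe_mk, hmean]
    congr 1
    rw [max_eq_left (by norm_num), div_one]
    simp [lim]
  rw [hGlim] at hG
  have hdiff : ∀ᶠ n in atTop, ‖∫ ω, f (pearsonStat fun j => T n j ω) ∂μ n
      - ∫ ω, f.compContinuous G (Z n ω) ∂μ n‖ ≤ 2 * ‖f‖ * ∫ ω, φ (Z n ω) ∂μ n := by
    filter_upwards [hhne] with n hn
    have hi : ∀ g : EuclideanSpace ℝ (Fin (m + 1)) → ℝ, Measurable g → Integrable (fun ω => f (g (Z n ω))) (μ n) := by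
      intro g hg
      refine Integrable.of_bound
        (f.continuous.measurable.comp (hg.comp (hZ n))).aestronglyMeasurable ‖f‖ ?_
      exact Eventually.of_forall fun ω => f.norm_coe_le_norm _
    have hp : ∀ ω, pearsonStat (fun j => T n j ω) = pearsonStat (Z n ω) := fun ω =>
      (pearsonStat_rescaledCounts hn.1 _).symm
    simp only [hp, BoundedContinuousFunction.compContinuous_apply]
    rw [← integral_sub (hi (fun z => pearsonStat z) (by unfold pearsonStat; fun_prop))
      (hi G G.continuous.measurable), ← integral_const_mul]
    refine norm_integral_le_of_norm_le ?_ (Eventually.of_forall fun ω => ?_)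
    · refine Integrable.const_mul ?_ _
      refine Integrable.of_bound
        (φ.continuous.measurable.comp (hZ n)).aestronglyMeasurable ‖φ‖ ?_
      exact Eventually.of_forall fun ω => φ.norm_coe_le_norm _
    · set z := Z n ω
      have hφ0 : 0 ≤ φ z := by
        simp only [φ, BoundedContinuousFunction.coe_ofNormedAddCommGroup]
        positivity
      by_cases hz : 1 / 2 ≤ (m + 1 : ℝ)⁻¹ * ∑ l, z l
      · have : pearsonStat z = G z := by
          simp only [pearsonStat, G, ContinuousMap.coe_mk]
          rw [max_eq_left hz]
        rw [this, sub_self, norm_zero]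
        positivity
      · push Not at hz
        have h1 : φ z = 1 := by
          simp only [φ, BoundedContinuousFunction.coe_ofNormedAddCommGroup]
          refine min_eq_left ?_
          rw [abs_sub_comm]
          have := le_abs_self (1 - (m + 1 : ℝ)⁻¹ * ∑ l, z l)
          linarith
        rw [h1, mul_one]
        refine (norm_sub_le _ _).trans ?_
        have h2 := f.norm_coe_le_norm (pearsonStat z)
        have h3 := f.norm_coe_le_norm (G z)
        linarith
  have h0 := squeeze_zero_norm' hdiff (by simpa using hφ.const_mul (2 * ‖f‖))
  simpa using h0.add hG

/-! ### Cell counts of a sample conditioned to avoid a set -/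

section CellCounts

variable {Ω F : Type*}

open Classical in
/-- The number of observations among the first `n` that fall into the cell `B`. -/
noncomputable def cellCount (Y : ℕ → Ω → F) (n : ℕ) (B : Set F) (ω : Ω) : ℕ :=
  ((Finset.range n).filter fun i => Y i ω ∈ B).card

/-- The event that none of the first `n` observations falls into `D`. -/
def avoidEvent (Y : ℕ → Ω → F) (n : ℕ) (D : Set F) : Set Ω :=
  {ω | ∀ i ∈ Finset.range n, Y i ω ∉ D}

theorem cellCount_eq_sum (Y : ℕ → Ω → F) (n : ℕ) (B : Set F) (ω : Ω) :
    cellCount Y n B ω = ∑ i ∈ Finset.range n, B.indicator (fun _ => 1) (Y i ω) := by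
  classical
  rw [cellCount, Finset.card_filter]
  exact Finset.sum_congr rfl fun i _ => by simp [Set.indicator_apply]

theorem cellCount_le (Y : ℕ → Ω → F) (n : ℕ) (B : Set F) (ω : Ω) : cellCount Y n B ω ≤ n := by
  classical
  simpa [cellCount] using Finset.card_filter_le (Finset.range n) fun i => Y i ω ∈ B

theorem cellCount_eq_zero_iff {Y : ℕ → Ω → F} {n : ℕ} {B : Set F} {ω : Ω} :
    cellCount Y n B ω = 0 ↔ ω ∈ avoidEvent Y n B := by
  classical
  simp [cellCount, avoidEvent, Finset.filter_eq_empty_iff]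

/-- By disjointness at most one indicator is nonzero, so the exponential is affine in the
indicators. -/
theorem exp_sum_mul_indicator {ι : Type*} [Fintype ι] {B : ι → Set F}
    (hB : Pairwise fun i j => Disjoint (B i) (B j)) (z : ι → ℂ) (x : F) :
    Complex.exp (∑ j, z j * (B j).indicator (fun _ => 1) x)
      = 1 + ∑ j, (Complex.exp (z j) - 1) * (B j).indicator (fun _ => 1) x := by
  by_cases hx : ∃ j, x ∈ B j
  · obtain ⟨j, hj⟩ := hx
    have h : ∀ k, k ≠ j → (B k).indicator (fun _ => (1 : ℂ)) x = 0 := fun k hk =>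
      Set.indicator_of_notMem (fun hk' => Set.disjoint_left.1 (hB hk) hk' hj) _
    rw [Finset.sum_eq_single j (fun k _ hk => by rw [h k hk, mul_zero]) (by simp),
      Finset.sum_eq_single j (fun k _ hk => by rw [h k hk, mul_zero]) (by simp),
      Set.indicator_of_mem hj]
    ring_nf
  · push Not at hx
    simp [Set.indicator_of_notMem (hx _)]

variable [MeasurableSpace Ω] [MeasurableSpace F]

theorem measurable_cellCount {Y : ℕ → Ω → F} (hY : ∀ i, Measurable (Y i)) (n : ℕ) {B : Set F}
    (hB : MeasurableSet B) : Measurable (cellCount Y n B) := by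
  have : cellCount Y n B = fun ω => ∑ i ∈ Finset.range n, B.indicator (fun _ => 1) (Y i ω) :=
    funext (cellCount_eq_sum Y n B)
  rw [this]
  exact Finset.measurable_sum _ fun i _ => (measurable_const.indicator hB).comp (hY i)

theorem measurableSet_avoidEvent {Y : ℕ → Ω → F} (hY : ∀ i, Measurable (Y i)) (n : ℕ) {D : Set F}
    (hD : MeasurableSet D) : MeasurableSet (avoidEvent Y n D) := by
  have : avoidEvent Y n D = ⋂ i ∈ Finset.range n, (Y i ⁻¹' D)ᶜ := by
    ext; simp [avoidEvent]
  rw [this]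
  exact Finset.measurableSet_biInter _ fun i _ => (hY i hD).compl

theorem integral_prod_range_comp {P : Measure Ω} {Y : ℕ → Ω → F} (hY : ∀ i, Measurable (Y i))
    (hindep : iIndepFun Y P) (hident : ∀ i, IdentDistrib (Y i) (Y 0) P P) {g : F → ℂ}
    (hg : Measurable g) (n : ℕ) :
    ∫ ω, ∏ i ∈ Finset.range n, g (Y i ω) ∂P = (∫ ω, g (Y 0 ω) ∂P) ^ n := by
  have h := (hindep.precomp (g := fun i : Fin n => (i : ℕ)) Fin.val_injective).integral_fun_prod_comp
    (f := fun _ => g) (fun i => (hY i).aemeasurable) (fun i => hg.aestronglyMeasurable)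
  simp only [Finset.prod_range]
  have hi : ∀ i, ∫ ω, g (Y i ω) ∂P = ∫ ω, g (Y 0 ω) ∂P := fun i =>
    ((hident i).comp hg).integral_eq
  simp [h, hi]

theorem integral_avoidEvent_exp_sum_cellCount {P : Measure Ω} [IsProbabilityMeasure P]
    {Y : ℕ → Ω → F} (hY : ∀ i, Measurable (Y i))
    (hindep : iIndepFun Y P) (hident : ∀ i, IdentDistrib (Y i) (Y 0) P P)
    {ι : Type*} [Fintype ι] {B : ι → Set F} (hBm : ∀ j, MeasurableSet (B j))
    (hB : Pairwise fun i j => Disjoint (B i) (B j)) {D : Set F} (hD : MeasurableSet D)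
    (hBD : ∀ j, Disjoint (B j) D) (n : ℕ) (z : ι → ℂ) :
    ∫ ω in avoidEvent Y n D, Complex.exp (∑ j, z j * (cellCount Y n (B j) ω : ℂ)) ∂P
      = ((1 - P.real (Y 0 ⁻¹' D) : ℝ)
        + ∑ j, (P.real (Y 0 ⁻¹' B j) : ℂ) * (Complex.exp (z j) - 1)) ^ n := by
  -- One-observation factor: the indicator of avoiding `D` times the exponential weight. The weight
  -- on the whole sample is the product of these, and independence gives an `n`-th power.
  let g : F → ℂ := fun x => Dᶜ.indicator (fun _ => 1) x
    + ∑ j, (Complex.exp (z j) - 1) * (B j).indicator (fun _ => 1) x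
  have hgm : Measurable g := by
    refine (measurable_const.indicator hD.compl).add (Finset.measurable_sum _ fun j _ => ?_)
    exact measurable_const.mul (measurable_const.indicator (hBm j))
  have hg : ∀ x, g x = Dᶜ.indicator (fun _ => 1) x *
      Complex.exp (∑ j, z j * (B j).indicator (fun _ => 1) x) := by
    intro x
    rw [exp_sum_mul_indicator hB]
    by_cases hx : x ∈ D
    · have : ∀ j, x ∉ B j := fun j hj => Set.disjoint_left.1 (hBD j) hj hx
      simp [g, hx, Set.indicator_of_notMem (this _)]
    · simp [g, hx]
  have h1 : ∀ ω, (avoidEvent Y n D).indicator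
      (fun ω => Complex.exp (∑ j, z j * (cellCount Y n (B j) ω : ℂ))) ω
      = ∏ i ∈ Finset.range n, g (Y i ω) := by
    intro ω
    simp only [hg, Finset.prod_mul_distrib]
    by_cases hω : ω ∈ avoidEvent Y n D
    · rw [Set.indicator_of_mem hω, Finset.prod_eq_one, one_mul, ← Complex.exp_sum,
        Finset.sum_comm]
      · congr 1
        refine Finset.sum_congr rfl fun j _ => ?_
        rw [← Finset.mul_sum, cellCount_eq_sum]
        push_cast
        congr 1
        refine Finset.sum_congr rfl fun i _ => ?_
        by_cases h : Y i ω ∈ B j <;> simp [h]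
      · intro i hi
        exact Set.indicator_of_mem (show Y i ω ∈ Dᶜ from hω i hi) _
    · rw [Set.indicator_of_notMem hω]
      obtain ⟨i, hi, hiD⟩ : ∃ i ∈ Finset.range n, Y i ω ∈ D := by
        simpa [avoidEvent] using hω
      rw [Finset.prod_eq_zero hi, zero_mul]
      simp [hiD]
  rw [← integral_indicator (measurableSet_avoidEvent hY n hD), integral_congr_ae
    (Eventually.of_forall h1), integral_prod_range_comp hY hindep hident hgm]
  congr 1
  have hi : ∀ {S : Set F}, MeasurableSet S → Integrable
      (fun ω => S.indicator (fun _ => (1 : ℂ)) (Y 0 ω)) P := fun hS =>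
    (integrable_const (1 : ℂ)).indicator (hY 0 hS)
  have hint : ∀ {S : Set F}, MeasurableSet S →
      ∫ ω, S.indicator (fun _ => (1 : ℂ)) (Y 0 ω) ∂P = (P.real (Y 0 ⁻¹' S) : ℂ) := by
    intro S hS
    have : (fun ω => S.indicator (fun _ => (1 : ℂ)) (Y 0 ω))
        = (Y 0 ⁻¹' S).indicator (fun _ => (1 : ℂ)) := rfl
    rw [this, integral_indicator_const _ (hY 0 hS)]
    simp
  simp only [g]
  rw [integral_add (hi hD.compl) (integrable_finsetSum _ fun j _ => (hi (hBm j)).const_mul _),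
    integral_finsetSum _ fun j _ => (hi (hBm j)).const_mul _, hint hD.compl]
  simp only [integral_const_mul, hint (hBm _), Set.preimage_compl]
  rw [probReal_compl_eq_one_sub (hY 0 hD)]
  exact congrArg _ (Finset.sum_congr rfl fun j _ => mul_comm _ _)

theorem measureReal_avoidEvent {P : Measure Ω} [IsProbabilityMeasure P]
    {Y : ℕ → Ω → F} (hY : ∀ i, Measurable (Y i))
    (hindep : iIndepFun Y P) (hident : ∀ i, IdentDistrib (Y i) (Y 0) P P)
    {D : Set F} (hD : MeasurableSet D) (n : ℕ) :
    P.real (avoidEvent Y n D) = (1 - P.real (Y 0 ⁻¹' D)) ^ n := by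
  -- With no cells at all, the formula reduces to the probability of avoiding `D`.
  have h := integral_avoidEvent_exp_sum_cellCount hY hindep hident (ι := Empty) (B := fun _ => ∅)
    (by simp) (by simp) hD (by simp) n (fun _ => 0)
  simp only [Finset.univ_eq_empty, Finset.sum_empty, Complex.exp_zero, integral_const, add_zero,
    measureReal_restrict_apply_univ, Complex.real_smul, mul_one] at h
  exact_mod_cast h

/-- Given that none of the first `n` observations falls into `D`, the counts of disjoint cells
outside `D` have the joint moment generating function of a multinomial vector. -/
theorem integral_cond_exp_sum_cellCount {P : Measure Ω} [IsProbabilityMeasure P]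
    {Y : ℕ → Ω → F} (hY : ∀ i, Measurable (Y i))
    (hindep : iIndepFun Y P) (hident : ∀ i, IdentDistrib (Y i) (Y 0) P P)
    {ι : Type*} [Fintype ι] {B : ι → Set F} (hBm : ∀ j, MeasurableSet (B j))
    (hB : Pairwise fun i j => Disjoint (B i) (B j)) {D : Set F} (hD : MeasurableSet D)
    (hBD : ∀ j, Disjoint (B j) D) (hD1 : P.real (Y 0 ⁻¹' D) < 1) (n : ℕ) (z : ι → ℂ) :
    ∫ ω, Complex.exp (∑ j, z j * (cellCount Y n (B j) ω : ℂ)) ∂P[|avoidEvent Y n D]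
      = (1 + ∑ j, ((P.real (Y 0 ⁻¹' B j) / (1 - P.real (Y 0 ⁻¹' D)) : ℝ) : ℂ)
        * (Complex.exp (z j) - 1)) ^ n := by
  have hq : (1 - P.real (Y 0 ⁻¹' D)) ≠ 0 := by linarith
  rw [ProbabilityTheory.cond, integral_smul_measure,
    integral_avoidEvent_exp_sum_cellCount hY hindep hident hBm hB hD hBD n z,
    ENNReal.toReal_inv, ← measureReal_def, measureReal_avoidEvent hY hindep hident hD n,
    Complex.real_smul]
  push_cast
  rw [← inv_pow, ← mul_pow]
  congr 1
  have hq' : (1 - (P.real (Y 0 ⁻¹' D) : ℂ)) ≠ 0 := by exact_mod_cast hq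
  rw [mul_add, inv_mul_cancel₀ hq', Finset.mul_sum]
  congr 1
  exact Finset.sum_congr rfl fun j _ => by field_simp

end CellCounts

/-! ### Exponential bounds for missed cells and misordered counts -/

section Chernoff

variable {Ω F : Type*} [MeasurableSpace Ω] [MeasurableSpace F]

/-- An exponential bound for linear combinations of cell counts of an avoiding sample. -/
theorem measureReal_cond_sum_cellCount_nonneg_le {P : Measure Ω} [IsProbabilityMeasure P]
    {Y : ℕ → Ω → F} (hY : ∀ i, Measurable (Y i))
    (hindep : iIndepFun Y P) (hident : ∀ i, IdentDistrib (Y i) (Y 0) P P)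
    {ι : Type*} [Fintype ι] {B : ι → Set F} (hBm : ∀ j, MeasurableSet (B j))
    (hB : Pairwise fun i j => Disjoint (B i) (B j)) {D : Set F} (hD : MeasurableSet D)
    (hBD : ∀ j, Disjoint (B j) D) (hD1 : P.real (Y 0 ⁻¹' D) < 1) (n : ℕ) (z : ι → ℝ) :
    (P[|avoidEvent Y n D]).real {ω | 0 ≤ ∑ j, z j * (cellCount Y n (B j) ω : ℝ)}
      ≤ Real.exp (n * ∑ j, P.real (Y 0 ⁻¹' B j) / (1 - P.real (Y 0 ⁻¹' D))
        * (Real.exp (z j) - 1)) := by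
  have hA : P (avoidEvent Y n D) ≠ 0 := by
    intro h
    have h1 := measureReal_avoidEvent hY hindep hident hD n
    rw [measureReal_def, h] at h1
    exact (pow_pos (sub_pos.2 hD1) n).ne h1
  have := cond_isProbabilityMeasure hA
  set μ := P[|avoidEvent Y n D]
  have hT : ∀ j, Measurable fun ω => (cellCount Y n (B j) ω : ℝ) := fun j =>
    measurable_from_top.comp (measurable_cellCount hY n (hBm j))
  have hL : Measurable fun ω => ∑ j, z j * (cellCount Y n (B j) ω : ℝ) :=
    Finset.measurable_sum _ fun j _ => (hT j).const_mul _
  have hbound : ∀ ω, ∑ j, z j * (cellCount Y n (B j) ω : ℝ) ≤ ∑ j, |z j| * n := fun ω =>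
    Finset.sum_le_sum fun j _ => mul_le_mul (le_abs_self _)
      (by exact_mod_cast cellCount_le Y n (B j) ω) (by positivity) (abs_nonneg _)
  have hmarkov := measure_ge_le_exp_mul_mgf (μ := μ)
    (X := fun ω => ∑ j, z j * (cellCount Y n (B j) ω : ℝ)) 0 zero_le_one (by
      simp only [one_mul]
      refine Integrable.of_bound (Real.measurable_exp.comp hL).aestronglyMeasurable
        (Real.exp (∑ j, |z j| * n)) (Eventually.of_forall fun ω => ?_)
      rw [Real.norm_eq_abs, Real.abs_exp]
      exact Real.exp_le_exp.2 (hbound ω))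
  simp only [mul_zero, Real.exp_zero, one_mul, mgf] at hmarkov
  refine hmarkov.trans ?_
  have hpgf := integral_cond_exp_sum_cellCount hY hindep hident hBm hB hD hBD hD1 n
    (fun j => (z j : ℂ))
  have hpgf' : ∫ ω, Real.exp (∑ j, z j * (cellCount Y n (B j) ω : ℝ)) ∂μ
      = (1 + ∑ j, P.real (Y 0 ⁻¹' B j) / (1 - P.real (Y 0 ⁻¹' D)) * (Real.exp (z j) - 1)) ^ n := by
    apply Complex.ofReal_injective
    rw [← integral_complex_ofReal]
    push_cast at hpgf ⊢
    exact hpgf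
  rw [hpgf', Real.exp_nat_mul]
  -- The base is compared through `1 + x ≤ exp x`. Its nonnegativity, needed to raise to the power
  -- `n`, holds because the conditional cell probabilities sum to at most 1.
  refine pow_le_pow_left₀ ?_ (by rw [add_comm]; exact Real.add_one_le_exp _) n
  have hsum : ∑ j, P.real (Y 0 ⁻¹' B j) ≤ 1 - P.real (Y 0 ⁻¹' D) := by
    rw [← probReal_compl_eq_one_sub (hY 0 hD), ← measureReal_biUnion_finset
      (fun i _ j _ hij => (hB hij).preimage _) fun j _ => hY 0 (hBm j)]
    refine measureReal_mono fun ω hω => ?_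
    simp only [Set.mem_iUnion] at hω
    obtain ⟨j, -, hj⟩ := hω
    exact fun h => Set.disjoint_left.1 (hBD j) hj h
  have h1 : ∑ j, P.real (Y 0 ⁻¹' B j) / (1 - P.real (Y 0 ⁻¹' D)) ≤ 1 := by
    rw [← Finset.sum_div]
    exact (div_le_one (sub_pos.2 hD1)).2 hsum
  have h2 : ∑ j, P.real (Y 0 ⁻¹' B j) / (1 - P.real (Y 0 ⁻¹' D)) * (-1) ≤
      ∑ j, P.real (Y 0 ⁻¹' B j) / (1 - P.real (Y 0 ⁻¹' D)) * (Real.exp (z j) - 1) := by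
    refine Finset.sum_le_sum fun j _ => mul_le_mul_of_nonneg_left ?_
      (div_nonneg measureReal_nonneg (sub_pos.2 hD1).le)
    linarith [Real.exp_pos (z j)]
  rw [← Finset.sum_mul] at h2
  linarith

theorem measureReal_cond_cellCount_eq_zero_le {P : Measure Ω} [IsProbabilityMeasure P]
    {Y : ℕ → Ω → F} (hY : ∀ i, Measurable (Y i))
    (hindep : iIndepFun Y P) (hident : ∀ i, IdentDistrib (Y i) (Y 0) P P)
    {B D : Set F} (hBm : MeasurableSet B) (hD : MeasurableSet D)
    (hBD : Disjoint B D) (hD1 : P.real (Y 0 ⁻¹' D) < 1) (n : ℕ) :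
    (P[|avoidEvent Y n D]).real {ω | cellCount Y n B ω = 0}
      ≤ Real.exp (-((1 - Real.exp (-1)) * (n * P.real (Y 0 ⁻¹' B)))) := by
  have h := measureReal_cond_sum_cellCount_nonneg_le hY hindep hident (ι := Unit)
    (B := fun _ => B) (fun _ => hBm) (fun i j hij => (hij rfl).elim) hD (fun _ => hBD) hD1 n
    (fun _ => -1)
  have hset : {ω | cellCount Y n B ω = 0}
      = {ω | 0 ≤ ∑ _j : Unit, (-1 : ℝ) * (cellCount Y n B ω : ℝ)} := by
    ext ω
    simp
  rw [hset]
  refine h.trans (Real.exp_le_exp.2 ?_)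
  simp only [Finset.univ_unique, Finset.sum_const, Finset.card_singleton, one_smul]
  have h1 : P.real (Y 0 ⁻¹' B) ≤ P.real (Y 0 ⁻¹' B) / (1 - P.real (Y 0 ⁻¹' D)) := by
    rw [le_div_iff₀ (sub_pos.2 hD1)]
    nlinarith [measureReal_nonneg (μ := P) (s := Y 0 ⁻¹' B),
      measureReal_nonneg (μ := P) (s := Y 0 ⁻¹' D)]
  have h2 : Real.exp (-1) < 1 := by rw [Real.exp_lt_one_iff]; norm_num
  have h3 : 0 ≤ (n : ℝ) * (1 - Real.exp (-1)) := mul_nonneg n.cast_nonneg (by linarith)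
  nlinarith [mul_le_mul_of_nonneg_left h1 h3]

theorem measureReal_cond_cellCount_le_cellCount_le {P : Measure Ω} [IsProbabilityMeasure P]
    {Y : ℕ → Ω → F} (hY : ∀ i, Measurable (Y i))
    (hindep : iIndepFun Y P) (hident : ∀ i, IdentDistrib (Y i) (Y 0) P P)
    {B B' D : Set F} (hBm : MeasurableSet B) (hBm' : MeasurableSet B') (hD : MeasurableSet D)
    (hBB : Disjoint B B') (hBD : Disjoint B D) (hBD' : Disjoint B' D)
    (hD1 : P.real (Y 0 ⁻¹' D) < 1) (n : ℕ) (hpos : 0 < n * P.real (Y 0 ⁻¹' B'))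
    (hlt : n * P.real (Y 0 ⁻¹' B') ≤ n * P.real (Y 0 ⁻¹' B)) :
    (P[|avoidEvent Y n D]).real {ω | cellCount Y n B ω ≤ cellCount Y n B' ω}
      ≤ Real.exp (-(√(n * P.real (Y 0 ⁻¹' B)) - √(n * P.real (Y 0 ⁻¹' B'))) ^ 2) := by
  set p := P.real (Y 0 ⁻¹' B) with hp
  set p' := P.real (Y 0 ⁻¹' B') with hp'
  set q := P.real (Y 0 ⁻¹' D) with hq
  set a := √(n * p) with ha
  set b := √(n * p') with hb
  have hb0 : 0 < b := Real.sqrt_pos.2 hpos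
  have ha0 : 0 < a := Real.sqrt_pos.2 (hpos.trans_le hlt)
  have ha2 : a ^ 2 = n * p := Real.sq_sqrt (hpos.trans_le hlt).le
  have hb2 : b ^ 2 = n * p' := Real.sq_sqrt hpos.le
  have h := measureReal_cond_sum_cellCount_nonneg_le hY hindep hident (ι := Fin 2)
    (B := ![B, B']) (by simp [Fin.forall_fin_two, hBm, hBm'])
    (by
      intro i j hij
      fin_cases i <;> fin_cases j <;> simp_all [hBB.symm]) hD
    (by simp [Fin.forall_fin_two, hBD, hBD']) hD1 n
    -- The weight `θ = log (a / b)` minimises `a² exp (-θ) + b² exp θ`; the minimum `2ab` turns the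
    -- exponent into `-(a - b)² / (1 - q)`.
    (![-Real.log (a / b), Real.log (a / b)])
  simp only [Fin.sum_univ_two, Matrix.cons_val_zero, Matrix.cons_val_one] at h
  have hsub : {ω | cellCount Y n B ω ≤ cellCount Y n B' ω} ⊆
      {ω | 0 ≤ -Real.log (a / b) * (cellCount Y n B ω : ℝ)
        + Real.log (a / b) * (cellCount Y n B' ω : ℝ)} := by
    intro ω hω
    have hω' : (cellCount Y n B ω : ℝ) ≤ cellCount Y n B' ω := by exact_mod_cast hω
    have hlog : 0 ≤ Real.log (a / b) :=
      Real.log_nonneg ((one_le_div hb0).2 (Real.sqrt_le_sqrt hlt))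
    change 0 ≤ -Real.log (a / b) * (cellCount Y n B ω : ℝ)
        + Real.log (a / b) * (cellCount Y n B' ω : ℝ)
    nlinarith
  refine (measureReal_mono hsub).trans (h.trans (Real.exp_le_exp.2 ?_))
  rw [← hp, ← hp', ← hq, Real.exp_neg, Real.exp_log (div_pos ha0 hb0)]
  have e1 : (n : ℝ) * (p / (1 - q) * ((a / b)⁻¹ - 1) + p' / (1 - q) * (a / b - 1))
      = -((a - b) ^ 2 / (1 - q)) := by
    have : (n : ℝ) * (p / (1 - q) * ((a / b)⁻¹ - 1) + p' / (1 - q) * (a / b - 1))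
      = ((n * p) * ((a / b)⁻¹ - 1) + (n * p') * (a / b - 1)) / (1 - q) := by ring
    rw [this, ← ha2, ← hb2, ← neg_div]
    congr 1
    field_simp
    ring
  rw [e1, neg_le_neg_iff, le_div_iff₀ (sub_pos.2 hD1)]
  nlinarith [sq_nonneg (a - b), measureReal_nonneg (μ := P) (s := Y 0 ⁻¹' D)]

end Chernoff

/-! ### Changing the conditioning event in a weak limit -/

/-- Weak convergence is kept when conditioning on events of probability tending to `1` and when
changing the variables off such events. -/
theorem tendsto_integral_cond_of_tendsto {Ω : Type*} [MeasurableSpace Ω] {μ : ℕ → Measure Ω}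
    [∀ n, IsProbabilityMeasure (μ n)] {E G : ℕ → Set Ω} (hE : ∀ n, MeasurableSet (E n))
    (hG : ∀ n, MeasurableSet (G n)) (hGE : ∀ n, G n ⊆ E n)
    (hG0 : Tendsto (fun n => (μ n).real (G n)ᶜ) atTop (𝓝 0)) {Y Y' : ℕ → Ω → ℝ}
    (hY : ∀ n, Measurable (Y n)) (hY' : ∀ n, Measurable (Y' n))
    (hYY' : ∀ᶠ n in atTop, ∀ ω ∈ G n, Y' n ω = Y n ω) {f : BoundedContinuousFunction ℝ ℝ}
    {c : ℝ} (hc : Tendsto (fun n => ∫ ω, f (Y n ω) ∂μ n) atTop (𝓝 c)) :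
    Tendsto (fun n => ∫ ω, f (Y' n ω) ∂(μ n)[|E n]) atTop (𝓝 c) := by
  have hE1 : Tendsto (fun n => (μ n).real (E n)) atTop (𝓝 1) := by
    refine tendsto_of_tendsto_of_tendsto_of_le_of_le (g := fun n => 1 - (μ n).real (G n)ᶜ)
      (by simpa using hG0.const_sub 1) tendsto_const_nhds (fun n => ?_) fun n => measureReal_le_one
    have : (μ n).real (G n) = 1 - (μ n).real (G n)ᶜ := by
      rw [probReal_compl_eq_one_sub (hG n)]; ring
    exact this.symm.le.trans (measureReal_mono (hGE n))
  have hi : ∀ n (W : Ω → ℝ), Measurable W → Integrable (fun ω => f (W ω)) (μ n) := fun n W hW =>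
    Integrable.of_bound (f.continuous.measurable.comp hW).aestronglyMeasurable ‖f‖
      (Eventually.of_forall fun ω => f.norm_coe_le_norm _)
  have hdiff : ∀ᶠ n in atTop, ‖∫ ω in E n, f (Y' n ω) ∂μ n - ∫ ω, f (Y n ω) ∂μ n‖
      ≤ 2 * ‖f‖ * (μ n).real (G n)ᶜ := by
    filter_upwards [hYY'] with n hn
    rw [← integral_indicator (hE n),
      ← integral_sub ((hi n _ (hY' n)).indicator (hE n)) (hi n _ (hY n)),
      show 2 * ‖f‖ * (μ n).real (G n)ᶜ = ∫ ω, (G n)ᶜ.indicator (fun _ => 2 * ‖f‖) ω ∂μ n by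
        rw [integral_indicator_const _ (hG n).compl, smul_eq_mul, mul_comm]]
    refine norm_integral_le_of_norm_le ((integrable_const _).indicator (hG n).compl)
      (Eventually.of_forall fun ω => ?_)
    by_cases hω : ω ∈ G n
    · simp [hω, hGE n hω, hn ω hω]
    · rw [Set.indicator_of_mem (show ω ∈ (G n)ᶜ from hω)]
      refine (norm_sub_le _ _).trans ?_
      have h1 : ‖(E n).indicator (fun ω => f (Y' n ω)) ω‖ ≤ ‖f‖ :=
        (norm_indicator_le_norm_self _ _).trans (f.norm_coe_le_norm _)
      linarith [f.norm_coe_le_norm (Y n ω)]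
  have h0 := squeeze_zero_norm' hdiff (by simpa using hG0.const_mul (2 * ‖f‖))
  have h1 : Tendsto (fun n => ∫ ω in E n, f (Y' n ω) ∂μ n) atTop (𝓝 c) := by
    simpa using h0.add hc
  have h2 := (hE1.inv₀ one_ne_zero).mul h1
  rw [inv_one, one_mul] at h2
  refine h2.congr fun n => ?_
  rw [ProbabilityTheory.cond, integral_smul_measure, ENNReal.toReal_inv, ← measureReal_def,
    smul_eq_mul]

/-! ### Cluster cells and their measurability -/

/-- The minimality inequalities make the graph closed, and a map with closed graph into a compact
space is continuous. -/
theorem continuous_simplexProj {d : ℕ} [NeZero d] :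
    Continuous (simplexProj : (Fin d → ℝ) → Fin d → ℝ) := by
  have : CompactSpace (stdSimplex ℝ (Fin d)) :=
    isCompact_iff_compactSpace.1 (isCompact_stdSimplex ℝ (Fin d))
  let g : (Fin d → ℝ) → stdSimplex ℝ (Fin d) := fun x => ⟨simplexProj x, (simplexProj_spec x).1⟩
  have hg : Continuous g := by
    have h : {p : (Fin d → ℝ) × stdSimplex ℝ (Fin d) | p.2 = g p.1} =
        ⋂ z ∈ stdSimplex ℝ (Fin d),
          {p | ∑ i, (p.1 i - p.2.1 i) ^ 2 ≤ ∑ i, (p.1 i - z i) ^ 2} := by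
      ext ⟨x, y⟩
      simp only [Set.mem_iInter]
      constructor
      · intro h z hz
        obtain rfl : y = g x := h
        exact (simplexProj_spec x).2 z hz
      · intro h
        exact Subtype.ext ((existsUnique_isSimplexProj x).unique ⟨y.2, h⟩ (simplexProj_spec x))
    have hcl : IsClosed {p : (Fin d → ℝ) × stdSimplex ℝ (Fin d) | p.2 = g p.1} := by
      rw [h]
      have hv : Continuous fun p : (Fin d → ℝ) × stdSimplex ℝ (Fin d) => (p.2 : Fin d → ℝ) :=
        continuous_subtype_val.comp continuous_snd
      exact isClosed_biInter fun z _ => isClosed_le (continuous_finsetSum _ fun i _ =>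
        (((continuous_apply i).comp continuous_fst).sub ((continuous_apply i).comp hv)).pow 2)
        (by fun_prop)
    refine continuous_iff_isClosed.2 fun C hC => ?_
    have h' : g ⁻¹' C = Prod.fst '' ({p : (Fin d → ℝ) × stdSimplex ℝ (Fin d) | p.2 = g p.1} ∩
        Prod.snd ⁻¹' C) := by
      ext x
      constructor
      · exact fun hx => ⟨(x, g x), ⟨rfl, hx⟩, rfl⟩
      · rintro ⟨⟨x, y⟩, ⟨hxy, hy⟩, rfl⟩
        exact (show y = g x from hxy) ▸ hy
    rw [h']
    exact isClosedMap_fst_of_compactSpace _ (hcl.inter (hC.preimage continuous_snd))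
  exact continuous_subtype_val.comp hg

theorem measurableSet_coneC {d : ℕ} (β : Finset (Fin d)) : MeasurableSet (coneC β) := by
  have : coneC β = stdSimplex ℝ (Fin d) ∩ ((⋂ i ∈ β, {x | 0 < x i}) ∩
      ⋂ i ∈ βᶜ, {x : Fin d → ℝ | x i = 0}) := by
    ext x
    simp only [coneC, Finset.mem_compl, Set.mem_inter_iff, Set.mem_iInter]
    rfl
  rw [this]
  refine (isClosed_stdSimplex ℝ (Fin d)).measurableSet.inter (MeasurableSet.inter ?_ ?_)
  · exact Finset.measurableSet_biInter _ fun i _ =>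
      measurableSet_lt measurable_const (measurable_pi_apply i)
  · exact Finset.measurableSet_biInter _ fun i _ =>
      measurableSet_eq_fun (measurable_pi_apply i) measurable_const

theorem disjoint_coneC {d : ℕ} {β γ : Finset (Fin d)} (h : β ≠ γ) :
    Disjoint (coneC β) (coneC γ) := by
  refine Set.disjoint_left.2 fun x hβ hγ => h ?_
  ext i
  constructor
  · intro hi
    by_contra hi'
    exact (hβ.2.1 i hi).ne' (hγ.2.2 i hi')
  · intro hi
    by_contra hi'
    exact (hγ.2.1 i hi).ne' (hβ.2.2 i hi')

theorem measurable_l1Norm {d : ℕ} : Measurable (l1Norm : (Fin d → ℝ) → ℝ) := by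
  unfold l1Norm
  fun_prop

/-- The points of norm larger than `u` whose rescaled projection lies in the cone of `β`. -/
def clusterCell {d : ℕ} (u : ℝ) (β : Finset (Fin d)) : Set (Fin d → ℝ) :=
  {x | simplexProj (u⁻¹ • x) ∈ coneC β ∧ u < l1Norm x}

theorem measurableSet_clusterCell {d : ℕ} [NeZero d] (u : ℝ) (β : Finset (Fin d)) :
    MeasurableSet (clusterCell u β) := by
  have h : Measurable fun x : Fin d → ℝ => simplexProj (u⁻¹ • x) :=
    (continuous_simplexProj.comp (continuous_const_smul u⁻¹)).measurable
  exact (h (measurableSet_coneC β)).inter (measurableSet_lt measurable_const measurable_l1Norm)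

theorem disjoint_clusterCell {d : ℕ} (u : ℝ) {β γ : Finset (Fin d)} (h : β ≠ γ) :
    Disjoint (clusterCell u β) (clusterCell u γ) :=
  Set.disjoint_left.2 fun _ hβ hγ => Set.disjoint_left.1 (disjoint_coneC h) hβ.1 hγ.1

theorem clusterCount_eq_cellCount {Ω : Type*} {d : ℕ} (X : ℕ → Ω → Fin d → ℝ)
    (u : ℕ → ℝ) (n : ℕ) (β : Finset (Fin d)) :
    clusterCount X u n β = cellCount X n (clusterCell (u n) β) := by
  funext ω
  unfold clusterCount cellCount
  congr

theorem level_mul_clusterProb {Ω : Type*} [MeasurableSpace Ω] {d : ℕ} (P : Measure Ω)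
    [IsProbabilityMeasure P] {X : ℕ → Ω → Fin d → ℝ} (hX : Measurable (X 0))
    (u : ℕ → ℝ) (n : ℕ) (β : Finset (Fin d)) :
    level P X u n * clusterProb P X u n β = n * P.real (X 0 ⁻¹' clusterCell (u n) β) := by
  have hm : MeasurableSet {ω | u n < l1Norm (X 0 ω)} :=
    measurableSet_lt measurable_const (measurable_l1Norm.comp hX)
  have hset : X 0 ⁻¹' clusterCell (u n) β = {ω | u n < l1Norm (X 0 ω)} ∩
      {ω | simplexProj ((u n)⁻¹ • X 0 ω) ∈ coneC β} := Set.inter_comm _ _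
  rw [level, clusterProb, hset, measureReal_def (P[|_]), cond_apply hm, ENNReal.toReal_mul,
    ENNReal.toReal_inv, ← measureReal_def, ← measureReal_def, mul_assoc]
  congr 1
  -- If the threshold is almost surely not exceeded, the conditional probability is a default value,
  -- but both sides vanish.
  by_cases h : P.real {ω | u n < l1Norm (X 0 ω)} = 0
  · rw [h, zero_mul]
    exact (le_antisymm ((measureReal_mono Set.inter_subset_left).trans h.le)
      measureReal_nonneg).symm
  · rw [mul_inv_cancel_left₀ h]

/-! ### Sorted counts and the score statistic -/

/-- The middle block of a decreasingly sorted multiset. -/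
theorem sum_sort_getD_middle {M M₁ M₂ M₃ : Multiset ℕ} (hM : M = M₁ + M₂ + M₃)
    (h₁₂ : ∀ a ∈ M₁, ∀ b ∈ M₂, b ≤ a) (h₂₃ : ∀ b ∈ M₂, ∀ c ∈ M₃, c ≤ b) {s₁ s₂ : ℕ} (hs : s₁ < s₂)
    (hc₁ : M₁.card = s₁) (hc₂ : M₂.card = s₂ - s₁) (f : ℕ → ℝ) :
    ∑ j ∈ Finset.Icc (s₁ + 1) s₂, f ((M.sort (· ≥ ·)).getD (j - 1) 0) = (M₂.map f).sum := by
  -- An element of the middle block, nonempty since `s₁ < s₂`, links the outer blocks by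
  -- transitivity.
  obtain ⟨b₀, hb₀⟩ : ∃ b, b ∈ M₂ := Multiset.card_pos_iff_exists_mem.1 (by omega)
  have hsort : M.sort (· ≥ ·) =
      M₁.sort (· ≥ ·) ++ (M₂.sort (· ≥ ·) ++ M₃.sort (· ≥ ·)) := by
    refine List.Perm.eq_of_pairwise (le := (· ≥ ·)) (fun a b _ _ h h' => le_antisymm h' h)
      (Multiset.pairwise_sort _ _) ?_ ?_
    · simp only [List.pairwise_append, Multiset.pairwise_sort, true_and, Multiset.mem_sort,
        List.mem_append]
      refine ⟨fun b hb c hc => h₂₃ b hb c hc, fun a ha b hb => ?_⟩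
      rcases hb with hb | hb
      · exact h₁₂ a ha b hb
      · exact (h₂₃ b₀ hb₀ b hb).trans (h₁₂ a ha b₀ hb₀)
    · rw [← Multiset.coe_eq_coe]
      simp only [← Multiset.coe_add, Multiset.sort_eq, hM, add_assoc]
  have hl₁ : (M₁.sort (· ≥ ·)).length = s₁ := by rw [Multiset.length_sort, hc₁]
  have hl₂ : (M₂.sort (· ≥ ·)).length = s₂ - s₁ := by rw [Multiset.length_sort, hc₂]
  have hmap : (M₂.map f).sum = ((M₂.sort (· ≥ ·)).map f).sum := by
    conv_lhs => rw [← Multiset.sort_eq M₂ (· ≥ ·)]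
    rw [Multiset.map_coe, Multiset.sum_coe]
  rw [hsort, hmap, ← Finset.Ico_succ_right_eq_Icc, Finset.sum_Ico_eq_sum_range]
  generalize M₁.sort (· ≥ ·) = L₁ at *
  generalize M₂.sort (· ≥ ·) = L₂ at *
  have hlen : Order.succ s₂ - (s₁ + 1) = L₂.length := by
    rw [hl₂, Order.succ_eq_add_one]; omega
  rw [hlen, ← Fin.sum_univ_fun_getElem L₂ f, Finset.sum_range]
  refine Finset.sum_congr rfl fun i _ => ?_
  congr 1
  rw [List.getD_append_right _ _ _ _ (by omega), List.getD_append _ _ _ _ (by omega)]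
  rw [List.getD_eq_getElem _ _ (by omega)]
  congr 1
  omega

/-- The level `k` cancels, so only the counts matter. When their mean is zero, both sides are 0 by
the convention for division by zero. -/
theorem scoreStat_eq_pearsonStat {k : ℝ} (hk : k ≠ 0) {s₁ s₂ : ℕ} (hs : s₁ < s₂) (T : ℕ → ℝ) :
    scoreStat k s₁ s₂ T = pearsonStat fun j : Fin (s₂ - s₁ - 1 + 1) => T (s₁ + 1 + j) := by
  have hsum : ∀ f : ℕ → ℝ, ∑ j ∈ Finset.Icc (s₁ + 1) s₂, f j
      = ∑ j : Fin (s₂ - s₁ - 1 + 1), f (s₁ + 1 + j) := by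
    intro f
    rw [← Finset.Ico_succ_right_eq_Icc, Finset.sum_Ico_eq_sum_range,
      Order.succ_eq_add_one, show s₂ + 1 - (s₁ + 1) = s₂ - s₁ - 1 + 1 by omega, Finset.sum_range]
  have hm : ((s₂ : ℝ) - s₁) = ((s₂ - s₁ - 1 : ℕ) : ℝ) + 1 := by
    rw [Nat.cast_sub (by omega), Nat.cast_sub hs.le]; push_cast; ring
  simp only [scoreStat, pearsonStat, hsum, hm]
  set A := ∑ j : Fin (s₂ - s₁ - 1 + 1), T (s₁ + 1 + j)
  set c : ℝ := (((s₂ - s₁ - 1 : ℕ) : ℝ) + 1)⁻¹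
  rw [← Finset.sum_div, mul_assoc k⁻¹]
  have : ∀ x : ℝ, (x / k - k⁻¹ * (c * A)) ^ 2 = (k⁻¹) ^ 2 * (x - c * A) ^ 2 := fun x => by ring
  simp only [this, ← Finset.mul_sum]
  by_cases hA : c * A = 0
  · simp [hA]
  · field_simp

theorem scoreStat_congr {k : ℝ} {s₁ s₂ : ℕ} {T T' : ℕ → ℕ}
    (h : ∀ f : ℕ → ℝ, ∑ j ∈ Finset.Icc (s₁ + 1) s₂, f (T j) = ∑ j ∈ Finset.Icc (s₁ + 1) s₂, f (T' j)) :
    scoreStat k s₁ s₂ (fun j => (T j : ℝ)) = scoreStat k s₁ s₂ (fun j => (T' j : ℝ)) := by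
  simp only [scoreStat]
  rw [h fun t => (t : ℝ)]
  exact congrArg _ (h fun t => ((t : ℝ) / k - _) ^ 2 / _)

theorem measurable_scoreStat {Ω : Type*} [MeasurableSpace Ω] (k : ℝ) (s₁ s₂ : ℕ) {T : ℕ → Ω → ℕ}
    (hT : ∀ j, Measurable (T j)) : Measurable fun ω => scoreStat k s₁ s₂ fun j => (T j ω : ℝ) := by
  have hT' : ∀ j, Measurable fun ω => (T j ω : ℝ) := fun j => measurable_from_top.comp (hT j)
  unfold scoreStat
  fun_prop

theorem measurable_orderedCount {Ω : Type*} [MeasurableSpace Ω] {d : ℕ} [NeZero d]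
    {X : ℕ → Ω → Fin d → ℝ} (hX : ∀ i, Measurable (X i)) (u : ℕ → ℝ) (n j : ℕ) :
    Measurable (orderedCount X u n j) := by
  let g : (Finset (Fin d) → ℕ) → ℕ := fun t =>
    ((((Finset.univ : Finset (Finset (Fin d))).filter (·.Nonempty)).val.map t).sort
      (· ≥ ·)).getD (j - 1) 0
  have hg : Measurable g := measurable_of_countable g
  exact hg.comp (measurable_pi_lambda _ fun β => by
    simp only [clusterCount_eq_cellCount]
    exact measurable_cellCount hX n (measurableSet_clusterCell (u n) β))

/-! ### The sample conditioned to have no stray observation -/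

section ConditionalSample

variable {Ω : Type*} [MeasurableSpace Ω] {d : ℕ}

/-- The points that fall into the cell of a nonempty cluster outside `S_k^∞`. -/
def strayCell (P : Measure Ω) (X : ℕ → Ω → Fin d → ℝ) (u : ℕ → ℝ) (n : ℕ) : Set (Fin d → ℝ) :=
  ⋃ β ∈ {β : Finset (Fin d) | β.Nonempty ∧ β ∉ clustersInfty P X u}, clusterCell (u n) β

open Classical in
/-- The law of the sample given that no observation falls into a stray cell (the unconditional law
in the degenerate case where this event has probability zero). -/
noncomputable def strayFree (P : Measure Ω) (X : ℕ → Ω → Fin d → ℝ) (u : ℕ → ℝ) (n : ℕ) :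
    Measure Ω :=
  if P (avoidEvent X n (strayCell P X u n)) = 0 then P
  else P[|avoidEvent X n (strayCell P X u n)]

instance (P : Measure Ω) [IsProbabilityMeasure P] (X : ℕ → Ω → Fin d → ℝ) (u : ℕ → ℝ) (n : ℕ) :
    IsProbabilityMeasure (strayFree P X u n) := by
  unfold strayFree
  split_ifs with h
  · infer_instance
  · exact cond_isProbabilityMeasure h

theorem measurableSet_strayCell [NeZero d] (P : Measure Ω) (X : ℕ → Ω → Fin d → ℝ) (u : ℕ → ℝ)
    (n : ℕ) : MeasurableSet (strayCell P X u n) :=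
  MeasurableSet.biUnion (Set.to_countable _) fun β _ => measurableSet_clusterCell (u n) β

theorem disjoint_clusterCell_strayCell {P : Measure Ω} {X : ℕ → Ω → Fin d → ℝ} {u : ℕ → ℝ} (n : ℕ)
    {β : Finset (Fin d)} (hβ : β ∈ clustersInfty P X u) :
    Disjoint (clusterCell (u n) β) (strayCell P X u n) := by
  refine Set.disjoint_iUnion₂_right.2 fun γ hγ => disjoint_clusterCell _ ?_
  rintro rfl
  exact hγ.2 hβ

theorem eventEq_subset_avoidEvent (P : Measure Ω) (X : ℕ → Ω → Fin d → ℝ) (u : ℕ → ℝ) (n : ℕ) :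
    eventEq P X u n ⊆ avoidEvent X n (strayCell P X u n) := by
  classical
  intro ω hω i hi hD
  obtain ⟨β, ⟨hβ, hβS⟩, hx⟩ := Set.mem_iUnion₂.1 hD
  refine hβS ?_
  have hω' : clustersInfty P X u = clustersHat X u n ω := hω
  rw [hω']
  refine ⟨hβ, ?_⟩
  rw [clusterCount_eq_cellCount, Nat.pos_iff_ne_zero, Ne, cellCount_eq_zero_iff]
  exact fun h => h i hi hx

theorem mem_eventEq_of_forall_pos {P : Measure Ω} {X : ℕ → Ω → Fin d → ℝ} {u : ℕ → ℝ} {n : ℕ}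
    {ω : Ω} (hω : ω ∈ avoidEvent X n (strayCell P X u n))
    (h : ∀ β ∈ clustersInfty P X u, cellCount X n (clusterCell (u n) β) ω ≠ 0) :
    ω ∈ eventEq P X u n := by
  refine Set.Subset.antisymm (fun β hβ => ⟨hβ.1, ?_⟩) ?_
  · rw [clusterCount_eq_cellCount]
    exact Nat.pos_iff_ne_zero.2 (h β hβ)
  rintro β ⟨hβ, hpos⟩
  by_contra hβS
  rw [clusterCount_eq_cellCount, Nat.pos_iff_ne_zero, Ne, cellCount_eq_zero_iff] at hpos
  exact hpos fun i hi hx => hω i hi (Set.mem_iUnion₂.2 ⟨β, ⟨hβ, hβS⟩, hx⟩)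

theorem measurableSet_eventEq [NeZero d] (P : Measure Ω) {X : ℕ → Ω → Fin d → ℝ}
    (hX : ∀ i, Measurable (X i)) (u : ℕ → ℝ) (n : ℕ) : MeasurableSet (eventEq P X u n) := by
  have : eventEq P X u n = avoidEvent X n (strayCell P X u n) ∩
      ⋂ β ∈ clustersInfty P X u, {ω | cellCount X n (clusterCell (u n) β) ω = 0}ᶜ := by
    ext ω
    constructor
    · intro hω
      refine ⟨eventEq_subset_avoidEvent P X u n hω, Set.mem_iInter₂.2 fun β hβ => ?_⟩
      have hω' : clustersInfty P X u = clustersHat X u n ω := hω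
      have h := (hω' ▸ hβ : β ∈ clustersHat X u n ω).2.ne'
      rwa [clusterCount_eq_cellCount] at h
    · exact fun hω => mem_eventEq_of_forall_pos hω.1 fun β hβ => Set.mem_iInter₂.1 hω.2 β hβ
  rw [this]
  refine (measurableSet_avoidEvent hX n (measurableSet_strayCell P X u n)).inter
    (MeasurableSet.biInter (Set.to_countable _) fun β _ => MeasurableSet.compl ?_)
  exact measurable_cellCount hX n (measurableSet_clusterCell (u n) β) (measurableSet_singleton 0)

theorem eventually_forall_le_mul_measureReal_clusterCell {P : Measure Ω} [IsProbabilityMeasure P]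
    {X : ℕ → Ω → Fin d → ℝ} (hX : ∀ i, Measurable (X i)) (u : ℕ → ℝ) (C : ℝ) :
    ∀ᶠ n : ℕ in atTop, ∀ β ∈ clustersInfty P X u,
      C ≤ n * P.real (X 0 ⁻¹' clusterCell (u n) β) := by
  rw [Filter.eventually_all_finite (Set.toFinite (clustersInfty P X u))]
  intro β hβ
  filter_upwards [hβ.2.eventually_ge_atTop C] with n hn
  rwa [← level_mul_clusterProb P (hX 0)]

variable [NeZero d] {P : Measure Ω} [IsProbabilityMeasure P] {X : ℕ → Ω → Fin d → ℝ}

/-- A cluster of `S_k^∞` eventually has a cell of positive probability, disjoint from the stray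
cell. This makes the conditioning nondegenerate. -/
theorem eventually_measureReal_strayCell_lt_one (hX : ∀ i, Measurable (X i)) {u : ℕ → ℝ}
    (hne : (clustersInfty P X u).Nonempty) :
    ∀ᶠ n : ℕ in atTop, P.real (X 0 ⁻¹' strayCell P X u n) < 1 := by
  obtain ⟨β, hβ⟩ := hne
  filter_upwards [eventually_forall_le_mul_measureReal_clusterCell (P := P) hX u 1] with n hn
  have h1 := hn β hβ
  have h2 : 0 < P.real (X 0 ⁻¹' clusterCell (u n) β) := by
    by_contra h
    have : P.real (X 0 ⁻¹' clusterCell (u n) β) = 0 :=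
      le_antisymm (not_lt.1 h) measureReal_nonneg
    rw [this] at h1
    norm_num at h1
  have h3 : P.real (X 0 ⁻¹' strayCell P X u n) ≤ P.real (X 0 ⁻¹' clusterCell (u n) β)ᶜ :=
    measureReal_mono fun ω hω hω' =>
      Set.disjoint_left.1 (disjoint_clusterCell_strayCell n hβ) hω' hω
  rw [probReal_compl_eq_one_sub (hX 0 (measurableSet_clusterCell _ _))] at h3
  linarith

variable (hX : ∀ i, Measurable (X i)) (hindep : iIndepFun X P)
  (hident : ∀ i, IdentDistrib (X i) (X 0) P P) {u : ℕ → ℝ}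

include hX hindep hident

theorem strayFree_eq_cond {n : ℕ} (h : P.real (X 0 ⁻¹' strayCell P X u n) < 1) :
    strayFree P X u n = P[|avoidEvent X n (strayCell P X u n)] := by
  rw [strayFree, if_neg]
  intro h0
  have h1 := measureReal_avoidEvent hX hindep hident (measurableSet_strayCell P X u n) n
  rw [measureReal_def, h0] at h1
  exact (pow_pos (sub_pos.2 h) n).ne h1

theorem tendsto_strayFree_cellCount_eq_zero {β : Finset (Fin d)} (hβ : β ∈ clustersInfty P X u) :
    Tendsto (fun n => (strayFree P X u n).real {ω | cellCount X n (clusterCell (u n) β) ω = 0})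
      atTop (𝓝 0) := by
  have h2 : 0 < 1 - Real.exp (-1) := by
    rw [sub_pos, Real.exp_lt_one_iff]; norm_num
  have h3 := Real.tendsto_exp_neg_atTop_nhds_zero.comp (hβ.2.const_mul_atTop h2)
  refine squeeze_zero' (Eventually.of_forall fun n => measureReal_nonneg) ?_ h3
  filter_upwards [eventually_measureReal_strayCell_lt_one hX ⟨β, hβ⟩] with n hn
  rw [strayFree_eq_cond hX hindep hident hn, Function.comp_apply,
    level_mul_clusterProb P (hX 0)]
  exact measureReal_cond_cellCount_eq_zero_le hX hindep hident (measurableSet_clusterCell _ _)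
    (measurableSet_strayCell P X u n) (disjoint_clusterCell_strayCell n hβ) hn n

/-- Without stray observations, the event can fail only if some cluster of `S_k^∞` is missed; a
union bound over finitely many clusters concludes. -/
theorem tendsto_strayFree_compl_eventEq (hne : (clustersInfty P X u).Nonempty) :
    Tendsto (fun n => (strayFree P X u n).real (eventEq P X u n)ᶜ) atTop (𝓝 0) := by
  classical
  have h1 := tendsto_finsetSum (Set.toFinite (clustersInfty P X u)).toFinset fun β hβ =>
    tendsto_strayFree_cellCount_eq_zero hX hindep hident ((Set.Finite.mem_toFinset _).1 hβ)
  rw [Finset.sum_const_zero] at h1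
  refine squeeze_zero' (Eventually.of_forall fun n => measureReal_nonneg) ?_ h1
  filter_upwards [eventually_measureReal_strayCell_lt_one hX hne] with n hn
  have hAm := measurableSet_avoidEvent hX n (measurableSet_strayCell P X u n)
  have h0 : (strayFree P X u n).real (avoidEvent X n (strayCell P X u n))ᶜ = 0 := by
    rw [strayFree_eq_cond hX hindep hident hn, measureReal_def, cond_apply hAm]
    simp
  have hsub : (eventEq P X u n)ᶜ ⊆ (avoidEvent X n (strayCell P X u n))ᶜ ∪
      ⋃ β ∈ (Set.toFinite (clustersInfty P X u)).toFinset,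
        {ω | cellCount X n (clusterCell (u n) β) ω = 0} := by
    intro ω hω
    by_contra hω'
    simp only [Set.mem_union, not_or, Set.mem_iUnion, not_exists, Set.mem_compl_iff,
      not_not, Set.Finite.mem_toFinset] at hω'
    exact hω (mem_eventEq_of_forall_pos hω'.1 fun β hβ => hω'.2 β hβ)
  refine (measureReal_mono hsub).trans ((measureReal_union_le _ _).trans ?_)
  rw [h0, zero_add]
  exact measureReal_biUnion_finset_le _ _

theorem tendsto_strayFree_cellCount_le {β γ : ℕ → Finset (Fin d)}
    (hβ : ∀ n, β n ∈ clustersInfty P X u) (hγ : ∀ n, γ n ∈ clustersInfty P X u)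
    (hsep : Tendsto (fun n => √(level P X u n * clusterProb P X u n (β n))
      - √(level P X u n * clusterProb P X u n (γ n))) atTop atTop) :
    Tendsto (fun n => (strayFree P X u n).real {ω | cellCount X n (clusterCell (u n) (β n)) ω
      ≤ cellCount X n (clusterCell (u n) (γ n)) ω}) atTop (𝓝 0) := by
  simp only [level_mul_clusterProb P (hX 0)] at hsep
  have h1 := Real.tendsto_exp_neg_atTop_nhds_zero.comp
    ((tendsto_pow_atTop two_ne_zero).comp hsep)
  refine squeeze_zero' (Eventually.of_forall fun n => measureReal_nonneg) ?_ h1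
  filter_upwards [eventually_measureReal_strayCell_lt_one hX ⟨_, hβ 0⟩,
    hsep.eventually_gt_atTop 0,
    eventually_forall_le_mul_measureReal_clusterCell (P := P) hX u 1] with n hn hs hpos
  rw [strayFree_eq_cond hX hindep hident hn]
  refine measureReal_cond_cellCount_le_cellCount_le hX hindep hident
    (measurableSet_clusterCell _ _) (measurableSet_clusterCell _ _)
    (measurableSet_strayCell P X u n) (disjoint_clusterCell _ ?_)
    (disjoint_clusterCell_strayCell n (hβ n)) (disjoint_clusterCell_strayCell n (hγ n)) hn n
    (one_pos.trans_le (hpos _ (hγ n))) ?_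
  · intro h
    rw [h, sub_self] at hs
    exact lt_irrefl _ hs
  · exact ((Real.sqrt_lt_sqrt_iff_of_pos (one_pos.trans_le (hpos _ (hβ n)))).1
      (sub_pos.1 hs)).le

/-- Convergence in distribution conditionally on `S_k^∞ = Ŝ_n` follows from convergence under the
stray-free law of variables that agree on subevents of probability tending to `1`. -/
theorem condTendstoInDistribution_eventEq (hne : (clustersInfty P X u).Nonempty) {ν : Measure ℝ}
    [IsProbabilityMeasure ν] {G : ℕ → Set Ω} (hG : ∀ n, MeasurableSet (G n))
    (hGE : ∀ n, G n ⊆ eventEq P X u n)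
    (hG0 : Tendsto (fun n => (strayFree P X u n).real (G n)ᶜ) atTop (𝓝 0)) {Y Y' : ℕ → Ω → ℝ}
    (hY : ∀ n, Measurable (Y n)) (hY' : ∀ n, Measurable (Y' n))
    (hYY' : ∀ᶠ n in atTop, ∀ ω ∈ G n, Y' n ω = Y n ω)
    (hlim : ∀ f : BoundedContinuousFunction ℝ ℝ,
      Tendsto (fun n => ∫ ω, f (Y n ω) ∂strayFree P X u n) atTop (𝓝 (∫ x, f x ∂ν))) :
    CondTendstoInDistribution P (eventEq P X u) Y' ν := by
  have hEm := fun n => measurableSet_eventEq P hX u n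
  have hAm := fun n => measurableSet_avoidEvent hX n (measurableSet_strayCell P X u n)
  have hq := eventually_measureReal_strayCell_lt_one hX hne
  refine ⟨fun n => (hY' n).aemeasurable, ?_, ?_⟩
  · filter_upwards [hq, (tendsto_strayFree_compl_eventEq hX hindep hident hne).eventually_lt_const
      one_pos] with n hn h1
    rw [probReal_compl_eq_one_sub (hEm n), strayFree_eq_cond hX hindep hident hn,
      measureReal_def, cond_apply (hAm n),
      Set.inter_eq_right.2 (eventEq_subset_avoidEvent P X u n)] at h1
    refine pos_iff_ne_zero.2 fun h0 => ?_
    rw [h0] at h1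
    simp at h1
  · refine FiniteMeasure.tendsto_iff_forall_integral_tendsto.2 fun f => ?_
    refine (tendsto_integral_cond_of_tendsto hEm hG hGE hG0 hY hY' hYY' (hlim f)).congr' ?_
    filter_upwards [hq] with n hn
    -- Since the event lies inside the avoiding event, conditioning on both in turn is conditioning
    -- on it alone.
    rw [strayFree_eq_cond hX hindep hident hn, cond_cond_eq_cond_inter (hAm n) (hEm n),
      Set.inter_eq_right.2 (eventEq_subset_avoidEvent P X u n)]
    exact (integral_map (hY' n).aemeasurable f.continuous.aestronglyMeasurable).symm

theorem tendsto_integral_scoreStat_strayFree {s₁ s₂ : ℕ} (hs : s₁ < s₂)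
    (hk : Tendsto (level P X u) atTop atTop) {b : ℕ → ℕ → Finset (Fin d)}
    (hbS : ∀ n, ∀ j ∈ Finset.Icc (s₁ + 1) s₂, b n j ∈ clustersInfty P X u)
    (hbinj : ∀ n, Set.InjOn (b n) (Finset.Icc (s₁ + 1) s₂)) {ρ : ℕ → ℝ}
    (hH₀ : ∀ᶠ n in atTop, ∀ j ∈ Finset.Icc (s₁ + 1) s₂, clusterProb P X u n (b n j) = ρ n)
    (f : BoundedContinuousFunction ℝ ℝ) :
    Tendsto (fun n => ∫ ω, f (scoreStat (level P X u n) s₁ s₂ fun j =>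
      (clusterCount X u n (b n j) ω : ℝ)) ∂strayFree P X u n) atTop
      (𝓝 (∫ x, f x ∂chiSquared (s₂ - s₁ - 1))) := by
  have hmem : ∀ j : Fin (s₂ - s₁ - 1 + 1), s₁ + 1 + (j : ℕ) ∈ Finset.Icc (s₁ + 1) s₂ := fun j =>
    Finset.mem_Icc.2 ⟨by omega, by omega⟩
  have h0 : s₁ + 1 ∈ Finset.Icc (s₁ + 1) s₂ := Finset.mem_Icc.2 ⟨by omega, by omega⟩
  have hq := eventually_measureReal_strayCell_lt_one hX ⟨_, hbS 0 _ h0⟩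
  let B : ∀ n, Fin (s₂ - s₁ - 1 + 1) → Set (Fin d → ℝ) := fun n j =>
    clusterCell (u n) (b n (s₁ + 1 + j))
  let r : ℕ → ℝ := fun n => P.real (X 0 ⁻¹' clusterCell (u n) (b n (s₁ + 1))) /
    (1 - P.real (X 0 ⁻¹' strayCell P X u n))
  have hr : Tendsto (fun n : ℕ => n * r n) atTop atTop := by
    refine tendsto_atTop.2 fun C => ?_
    filter_upwards [hq, eventually_forall_le_mul_measureReal_clusterCell (P := P) hX u (max C 0)]
      with n hn hC
    have h1 := hC _ (hbS n _ h0)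
    rw [← mul_div_assoc, le_div_iff₀ (sub_pos.2 hn)]
    have h2 : (0 : ℝ) ≤ P.real (X 0 ⁻¹' strayCell P X u n) := measureReal_nonneg
    nlinarith [le_max_left C 0, le_max_right C 0]
  have hBm : ∀ n j, MeasurableSet (B n j) := fun n j => measurableSet_clusterCell _ _
  refine (tendsto_integral_pearsonStat (strayFree P X u)
    (fun n j ω => (cellCount X n (B n j) ω : ℝ))
    (fun n j => measurable_from_top.comp (measurable_cellCount hX n (hBm n j))) r hr ?_ f).congr' ?_
  · filter_upwards [hq, hH₀, hk.eventually_gt_atTop 0] with n hn hH hkn z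
    rw [strayFree_eq_cond hX hindep hident hn, Finset.mul_sum]
    refine (integral_cond_exp_sum_cellCount hX hindep hident (hBm n) ?_
      (measurableSet_strayCell P X u n)
      (fun j => disjoint_clusterCell_strayCell n (hbS n _ (hmem j))) hn n z).trans ?_
    · intro i j hij
      refine disjoint_clusterCell _ fun h => hij ?_
      have := hbinj n (hmem i) (hmem j) h
      exact Fin.ext (by omega)
    · congr 2
      refine Finset.sum_congr rfl fun j _ => ?_
      have hn0 : (n : ℝ) ≠ 0 := by
        rintro h
        simp [level, h] at hkn
      have hp : P.real (X 0 ⁻¹' B n j) = P.real (X 0 ⁻¹' clusterCell (u n) (b n (s₁ + 1))) := by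
        -- The null hypothesis concerns probabilities given exceedance; multiplying by the level
        -- turns it into equality of the unconditional cell probabilities.
        apply mul_left_cancel₀ hn0
        simp only [B]
        rw [← level_mul_clusterProb P (hX 0), ← level_mul_clusterProb P (hX 0), hH _ (hmem j),
          hH _ h0]
      simp only [r, hp]
  · filter_upwards [hk.eventually_gt_atTop 0] with n hn
    simp only [scoreStat_eq_pearsonStat hn.ne' hs, clusterCount_eq_cellCount, B]

end ConditionalSample

/-! ### Identification of the ordered counts and conclusion -/

/-- The ordered counts with ranks in `(s₁, s₂]` are the counts of the clusters numbered
`s₁ + 1, …, s₂` as soon as the latter are ranked after the first `s₁` clusters and before the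
remaining ones. -/
theorem sum_orderedCount_eq {Ω : Type*} {d : ℕ} {X : ℕ → Ω → Fin d → ℝ} {u : ℕ → ℝ} {n : ℕ} {ω : Ω}
    {N s₁ s₂ : ℕ} (hs : s₁ < s₂) (hs₂ : s₂ ≤ N) {S : Set (Finset (Fin d))}
    (hS : S = clustersHat X u n ω)
    {b : ℕ → Finset (Fin d)} (hb : Set.BijOn b (Set.Icc 1 N) S)
    (h₁₂ : ∀ j ∈ Finset.Icc 1 s₁, ∀ l ∈ Finset.Icc (s₁ + 1) s₂,
      clusterCount X u n (b l) ω ≤ clusterCount X u n (b j) ω)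
    (h₂₃ : ∀ l ∈ Finset.Icc (s₁ + 1) s₂, ∀ j ∈ Finset.Icc (s₂ + 1) N,
      clusterCount X u n (b j) ω ≤ clusterCount X u n (b l) ω) (f : ℕ → ℝ) :
    ∑ j ∈ Finset.Icc (s₁ + 1) s₂, f (orderedCount X u n j ω)
      = ∑ j ∈ Finset.Icc (s₁ + 1) s₂, f (clusterCount X u n (b j) ω) := by
  classical
  let c : Finset (Fin d) → ℕ := fun β => clusterCount X u n β ω
  let U := (Finset.univ : Finset (Finset (Fin d))).filter (·.Nonempty)
  let F₁ := (Finset.Icc 1 s₁).image b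
  let F₂ := (Finset.Icc (s₁ + 1) s₂).image b
  have hinj : ∀ {i j}, 1 ≤ i → i ≤ N → 1 ≤ j → j ≤ N → b i = b j → i = j :=
    fun h1 h2 h3 h4 h => hb.injOn ⟨h1, h2⟩ ⟨h3, h4⟩ h
  have hinj₁ : Set.InjOn b (Finset.Icc 1 s₁) := by
    intro i hi j hj h
    simp only [Finset.coe_Icc, Set.mem_Icc] at hi hj
    exact hinj (by omega) (by omega) (by omega) (by omega) h
  have hinj₂ : Set.InjOn b (Finset.Icc (s₁ + 1) s₂) := by
    intro i hi j hj h
    simp only [Finset.coe_Icc, Set.mem_Icc] at hi hj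
    exact hinj (by omega) (by omega) (by omega) (by omega) h
  have hdisj : Disjoint F₁ F₂ := by
    rw [Finset.disjoint_left]
    intro β h1 h2
    obtain ⟨i, hi, rfl⟩ := Finset.mem_image.1 h1
    obtain ⟨j, hj, hij⟩ := Finset.mem_image.1 h2
    rw [Finset.mem_Icc] at hi hj
    have := hinj (by omega) (by omega) (by omega) (by omega) hij
    omega
  have hsub : F₁.disjUnion F₂ hdisj ⊆ U := by
    intro β hβ
    have hb' : ∀ i, 1 ≤ i → i ≤ N → b i ∈ U := fun i h1 h2 =>
      Finset.mem_filter.2 ⟨Finset.mem_univ _, (hS ▸ hb.mapsTo ⟨h1, h2⟩ :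
        b i ∈ clustersHat X u n ω).1⟩
    rw [Finset.mem_disjUnion] at hβ
    rcases hβ with h | h <;> obtain ⟨i, hi, rfl⟩ := Finset.mem_image.1 h <;>
      rw [Finset.mem_Icc] at hi <;> exact hb' i (by omega) (by omega)
  have hM : U.val.map c = F₁.val.map c + F₂.val.map c + (U \ F₁.disjUnion F₂ hdisj).val.map c := by
    have hU : U = (F₁.disjUnion F₂ hdisj).disjUnion (U \ F₁.disjUnion F₂ hdisj)
        Finset.disjoint_sdiff := by
      rw [Finset.disjUnion_eq_union, Finset.union_sdiff_of_subset hsub]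
    conv_lhs => rw [hU]
    rw [Finset.disjUnion_val, Finset.disjUnion_val, Multiset.map_add, Multiset.map_add]
  have key := sum_sort_getD_middle hM (s₁ := s₁) (s₂ := s₂) ?_ ?_ hs ?_ ?_ f
  · refine key.trans ?_
    rw [Multiset.map_map]
    change ∑ β ∈ F₂, f (c β) = _
    exact Finset.sum_image hinj₂
  · intro a ha a' ha'
    obtain ⟨β, hβ, rfl⟩ := Multiset.mem_map.1 ha
    obtain ⟨γ, hγ, rfl⟩ := Multiset.mem_map.1 ha'
    obtain ⟨j, hj, rfl⟩ := Finset.mem_image.1 (show β ∈ F₁ from hβ)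
    obtain ⟨l, hl, rfl⟩ := Finset.mem_image.1 (show γ ∈ F₂ from hγ)
    exact h₁₂ j hj l hl
  · intro a ha a' ha'
    obtain ⟨β, hβ, rfl⟩ := Multiset.mem_map.1 ha
    obtain ⟨γ, hγ, rfl⟩ := Multiset.mem_map.1 ha'
    obtain ⟨l, hl, rfl⟩ := Finset.mem_image.1 (show β ∈ F₂ from hβ)
    rw [Finset.mem_val, Finset.mem_sdiff, Finset.mem_disjUnion, not_or, Finset.mem_filter] at hγ
    -- Outside `S` the counts vanish on this event, so those clusters rank last; a nonzero count
    -- places the cluster in the numbering, after rank `s₂`.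
    by_cases h0 : c γ = 0
    · rw [h0]
      exact Nat.zero_le _
    · have hγS : γ ∈ S := by
        rw [hS]
        exact ⟨hγ.1.2, Nat.pos_iff_ne_zero.2 h0⟩
      obtain ⟨j, hj, rfl⟩ := hb.surjOn hγS
      refine h₂₃ l hl j (Finset.mem_Icc.2 ⟨?_, hj.2⟩)
      by_contra hlt
      rcases Nat.lt_or_ge s₁ j with h | h
      · exact hγ.2.2 (Finset.mem_image_of_mem b (Finset.mem_Icc.2 ⟨by omega, by omega⟩))
      · exact hγ.2.1 (Finset.mem_image_of_mem b (Finset.mem_Icc.2 ⟨hj.1, h⟩))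
  · rw [Multiset.card_map, Finset.card_val, Finset.card_image_of_injOn hinj₁, Nat.card_Icc]
    omega
  · rw [Multiset.card_map, Finset.card_val, Finset.card_image_of_injOn hinj₂, Nat.card_Icc]
    omega

theorem mainTheorem2 {Ω : Type*} [MeasurableSpace Ω] (P : Measure Ω) [IsProbabilityMeasure P]
    {d : ℕ} (X : ℕ → Ω → Fin d → ℝ)
    (hmeas : ∀ i, Measurable (X i))
    (hnonneg : ∀ i, ∀ᵐ ω ∂P, ∀ l, 0 ≤ X i ω l)
    (hindep : iIndepFun X P)
    (hident : ∀ i, IdentDistrib (X i) (X 0) P P)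
    (u : ℕ → ℝ) (hu : Tendsto u atTop atTop)
    (hk : Tendsto (level P X u) atTop atTop)
    (s₁ s₂ : ℕ) (hs : s₁ < s₂) (hs₂ : s₂ ≤ (clustersInfty P X u).ncard)
    -- `b n 1, b n 2, …` is a numbering of the clusters of `S_k^∞`
    (b : ℕ → ℕ → Finset (Fin d))
    (hb : ∀ n, Set.BijOn (b n) (Set.Icc 1 (clustersInfty P X u).ncard) (clustersInfty P X u))
    -- the null hypothesis
    (ρ : ℕ → ℝ)
    (hH₀ : ∀ᶠ n in atTop, ∀ j ∈ Finset.Icc (s₁ + 1) s₂, clusterProb P X u n (b n j) = ρ n) :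
    -- the statistic built on the counts of the clusters numbered `s₁ + 1, …, s₂`
    CondTendstoInDistribution P (eventEq P X u)
      (fun n ω => scoreStat (level P X u n) s₁ s₂ fun j => (clusterCount X u n (b n j) ω : ℝ))
      (chiSquared (s₂ - s₁ - 1)) ∧
    -- the statistic built on the ordered counts, when the other clusters of `S_k^∞` are
    -- asymptotically ranked before, respectively after, the tested ones
    ((∀ j ∈ Finset.Icc 1 s₁, Tendsto (fun n =>
        √(level P X u n * clusterProb P X u n (b n j)) - √(level P X u n * ρ n)) atTop atTop) →
      (∀ j ∈ Finset.Icc (s₂ + 1) (clustersInfty P X u).ncard, Tendsto (fun n =>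
        √(level P X u n * ρ n) - √(level P X u n * clusterProb P X u n (b n j))) atTop atTop) →
      CondTendstoInDistribution P (eventEq P X u)
        (fun n ω => scoreStat (level P X u n) s₁ s₂ fun j => (orderedCount X u n j ω : ℝ))
        (chiSquared (s₂ - s₁ - 1))) := by
  have hne : (clustersInfty P X u).Nonempty :=
    Set.nonempty_of_ncard_ne_zero (by omega)
  have hd : NeZero d := by
    obtain ⟨β, ⟨i, -⟩, -⟩ := hne
    exact ⟨fun h => (h ▸ i).elim0⟩
  have hbS : ∀ n, ∀ j, 1 ≤ j → j ≤ (clustersInfty P X u).ncard → b n j ∈ clustersInfty P X u :=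
    fun n j h1 h2 => (hb n).mapsTo ⟨h1, h2⟩
  have hbS' : ∀ n, ∀ j ∈ Finset.Icc (s₁ + 1) s₂, b n j ∈ clustersInfty P X u := fun n j hj => by
    rw [Finset.mem_Icc] at hj
    exact hbS n j (by omega) (by omega)
  have hbinj : ∀ n, Set.InjOn (b n) (Finset.Icc (s₁ + 1) s₂) := fun n =>
    (hb n).injOn.mono fun j hj => by
      simp only [Finset.coe_Icc, Set.mem_Icc] at hj ⊢
      omega
  have hcm : ∀ n β, Measurable (clusterCount X u n β) := fun n β => by
    rw [clusterCount_eq_cellCount]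
    exact measurable_cellCount hmeas n (measurableSet_clusterCell _ _)
  have hEm := fun n => measurableSet_eventEq P hmeas u n
  have hE0 := tendsto_strayFree_compl_eventEq hmeas hindep hident hne
  have hYm : ∀ n, Measurable fun ω => scoreStat (level P X u n) s₁ s₂ fun j =>
      (clusterCount X u n (b n j) ω : ℝ) := fun n =>
    measurable_scoreStat _ _ _ fun j => hcm n (b n j)
  have hlim := tendsto_integral_scoreStat_strayFree hmeas hindep hident hs hk hbS' hbinj hH₀
  refine ⟨condTendstoInDistribution_eventEq hmeas hindep hident hne hEm (fun n => subset_rfl) hE0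
    hYm hYm (Eventually.of_forall fun n ω _ => rfl) hlim, fun hbefore hafter => ?_⟩
  let bad : ℕ → ℕ → ℕ → Set Ω := fun n j l =>
    {ω | clusterCount X u n (b n j) ω ≤ clusterCount X u n (b n l) ω}
  have hbadm : ∀ n j l, MeasurableSet (bad n j l) := fun n j l =>
    measurableSet_le (hcm n _) (hcm n _)
  have hbad : ∀ j l, 1 ≤ j → j ≤ (clustersInfty P X u).ncard → 1 ≤ l →
      l ≤ (clustersInfty P X u).ncard → Tendsto (fun n => √(level P X u n * clusterProb P X u n (b n j))
        - √(level P X u n * clusterProb P X u n (b n l))) atTop atTop →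
      Tendsto (fun n => (strayFree P X u n).real (bad n j l)) atTop (𝓝 0) := by
    intro j l hj hj' hl hl' h
    simpa only [bad, clusterCount_eq_cellCount] using tendsto_strayFree_cellCount_le hmeas hindep
      hident (fun n => hbS n j hj hj') (fun n => hbS n l hl hl') h
  -- Only comparisons with the tested block are needed: the order inside each of the three blocks is
  -- irrelevant.
  let pairs : Finset (ℕ × ℕ) := Finset.Icc 1 s₁ ×ˢ Finset.Icc (s₁ + 1) s₂ ∪
    Finset.Icc (s₁ + 1) s₂ ×ˢ Finset.Icc (s₂ + 1) (clustersInfty P X u).ncard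
  have hpairs : ∀ p ∈ pairs, Tendsto (fun n => (strayFree P X u n).real (bad n p.1 p.2)) atTop
      (𝓝 0) := by
    rintro ⟨j, l⟩ hp
    simp only [pairs, Finset.mem_union, Finset.mem_product] at hp
    rcases hp with ⟨hj, hl⟩ | ⟨hj, hl⟩
    · have hj' := Finset.mem_Icc.1 hj
      have hl' := Finset.mem_Icc.1 hl
      refine hbad j l (by omega) (by omega) (by omega) (by omega) ((hbefore j hj).congr' ?_)
      filter_upwards [hH₀] with n hn
      rw [hn l hl]
    · have hj' := Finset.mem_Icc.1 hj
      have hl' := Finset.mem_Icc.1 hl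
      refine hbad j l (by omega) (by omega) (by omega) (by omega) ((hafter l hl).congr' ?_)
      filter_upwards [hH₀] with n hn
      rw [hn j hj]
  -- Ties count as bad, so on `G` the required comparisons are strict, although weak ones suffice
  -- for sorting.
  let G : ℕ → Set Ω := fun n => eventEq P X u n \ ⋃ p ∈ pairs, bad n p.1 p.2
  have hGm : ∀ n, MeasurableSet (G n) := fun n =>
    (hEm n).diff (Finset.measurableSet_biUnion _ fun p _ => hbadm n p.1 p.2)
  have hG0 : Tendsto (fun n => (strayFree P X u n).real (G n)ᶜ) atTop (𝓝 0) := by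
    have h := hE0.add (tendsto_finsetSum pairs hpairs)
    rw [Finset.sum_const_zero, add_zero] at h
    refine squeeze_zero (fun n => measureReal_nonneg) (fun n => ?_) h
    have hc : (G n)ᶜ = (eventEq P X u n)ᶜ ∪ ⋃ p ∈ pairs, bad n p.1 p.2 := by
      rw [Set.compl_sdiff, Set.union_comm]
    rw [hc]
    exact (measureReal_union_le _ _).trans
      (add_le_add le_rfl (measureReal_biUnion_finset_le _ _))
  refine condTendstoInDistribution_eventEq hmeas hindep hident hne hGm
    (fun n => Set.sdiff_subset) hG0 hYm
    (fun n => measurable_scoreStat _ _ _ fun j => measurable_orderedCount hmeas u n j)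
    (Eventually.of_forall fun n ω hω => scoreStat_congr fun f => ?_) hlim
  have hnot : ∀ p ∈ pairs, clusterCount X u n (b n p.2) ω ≤ clusterCount X u n (b n p.1) ω := by
    intro p hp
    by_contra hlt
    exact hω.2 (Set.mem_iUnion₂.2 ⟨p, hp, (not_le.1 hlt).le⟩)
  refine sum_orderedCount_eq hs hs₂ hω.1 (hb n) (fun j hj l hl => hnot (j, l) ?_)
    (fun l hl j hj => hnot (l, j) ?_) f
  · exact Finset.mem_union_left _ (Finset.mem_product.2 ⟨hj, hl⟩)
  · exact Finset.mem_union_right _ (Finset.mem_product.2 ⟨hl, hj⟩)
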